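/- Let $d\ge 2$ and let $\mathbb Z^d$ carry its nearest-neighbour structure $\sim$. For a finite $\Lambda\subset\mathbb Z^d$ with external boundary $\partial\Lambda=\{y\notin\Lambda:\exists x\in\Lambda,\ x\sim y\}$, $n\in\mathbb Z$ and $\phi:\Lambda\to\mathbb Z$ let $$\mathcal H^n_\Lambda(\phi)=\frac12\sum_{x,y\in\Lambda,\ x\sim y}|\phi(x)-\phi(y)|+\sum_{x\in\Lambda,\ y\in\partial\Lambda,\ x\sim y}|\phi(x)-n|,$$ and for $\beta>0$, $h\in\mathbb R$ let $$\mathcal Z^n_{\Lambda,\beta}=\sum_{\phi:\Lambda\to\mathbb Z}e^{-\beta\mathcal H^n_\Lambda(\phi)},\qquad \mathcal Z^{n,h}_{\Lambda,\beta}=\sum_{\phi:\Lambda\to\mathbb Z}e^{-\beta\mathcal H^n_\Lambda(\phi)+h|\{x\in\Lambda:\phi(x)=0\}|}.$$ With $\Lambda_N=\{1,\dots,N\}^d$ set $$\mathrm f(\beta)=\lim_{N\to\infty}\frac{1}{N^d}\log\mathcal Z^n_{\Lambda_N,\beta},\qquad \mathrm f(\beta,h)=\lim_{N\to\infty}\frac1{N^d}\log\mathcal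 Z^{n,h}_{\Lambda_N,\beta},$$ $$\bar{\mathrm f}_\beta(h)=\mathrm f(\beta,h)-\mathrm f(\beta),\qquad h_c(\beta)=\inf\{h\in\mathbb R:\bar{\mathrm f}_\beta(h)>0\}.$$ Let $\mathbf E_{\Lambda,\beta}$ be the expectation under the probability measure on $\mathbb Z^\Lambda$ proportional to $e^{-\beta\mathcal H^0_\Lambda}$. Call $\beta_0>0$ a rigidity threshold if there is $c>0$ such that for every $\beta>\beta_0$ there is a probability measure $\mathbf P_\beta$ on $\mathbb Z^{\mathbb Z^d}$, with expectation $\mathbf E_\beta$, such that for every non-empty finite $A\subset\mathbb Z^d$, every function $f$ with values in $[0,1]$ of the heights $(\phi(x))_{x\in A}$, and every finite $\Lambda\supset A$, $$|\mathbf E_{\Lambda,\beta}[f(\phi)]-\mathbf E_\beta[f(\phi)]|\le |A|\,e^{-c\beta d(\partial\Lambda,A)},$$ where $d(\cdot,\cdot)$ is the $\ell_1$ distance between sets. **Proposition.** The following holds for all $\beta\ge\beta_0$ whenever $\beta_0$ is a rigidity threshold, and it also holds (without reference to rigidity thresholds) for all $\beta\ge b$, for some constant $b>0$ depending only on $d$.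 The limits that define $\mathrm f(\beta)$ and $\mathrm f(\beta,h)$ exist for all $h\in\mathbb R$ and $n\in\mathbb Z$ and do not depend on $n$; $h_c(\beta)=0$; and there is a constant $c_\beta>0$ such that $$\bar{\mathrm f}_\beta(h)\sim c_\beta h\qquad\text{as } h\to0+.$$ Moreover the transition is of first order: $\bar{\mathrm f}_\beta$ is not differentiable at $h_c(\beta)=0$. -/

import Mathlib

namespace SOS

/-- The `ℓ¹` distance on `ℤ^d`. -/
def l1dist {d : ℕ} (x y : Fin d → ℤ) : ℕ := ∑ i, (x i - y i).natAbs

/-- Nearest neighbours in the lattice `ℤ^d`. -/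
def Adj {d : ℕ} (x y : Fin d → ℤ) : Prop := l1dist x y = 1

instance {d : ℕ} (x y : Fin d → ℤ) : Decidable (Adj x y) :=
  inferInstanceAs (Decidable (l1dist x y = 1))

/-- The external boundary `∂Λ` of a finite set `Λ ⊂ ℤ^d`; see `mem_boundary`. -/
noncomputable def boundary {d : ℕ} (Λ : Finset (Fin d → ℤ)) : Finset (Fin d → ℤ) :=
  (Λ.biUnion fun x => (Finset.Icc (x - 1) (x + 1)).filter fun y => Adj x y) \ Λ

theorem mem_boundary {d : ℕ} (Λ : Finset (Fin d → ℤ)) (y : Fin d → ℤ) :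
    y ∈ boundary Λ ↔ y ∉ Λ ∧ ∃ x ∈ Λ, Adj x y := by
  have key : ∀ x : Fin d → ℤ, Adj x y → y ∈ Finset.Icc (x - 1) (x + 1) := by
    intro x h
    have hi : ∀ i, (x i - y i).natAbs ≤ 1 := fun i =>
      le_of_le_of_eq (Finset.single_le_sum (f := fun i => (x i - y i).natAbs)
        (fun _ _ => Nat.zero_le _) (Finset.mem_univ i)) h
    rw [Finset.mem_Icc, Pi.le_def, Pi.le_def]
    constructor <;> intro i <;> have := hi i <;>
      simp only [Pi.sub_apply, Pi.add_apply, Pi.one_apply] <;> omega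
  simp only [boundary, Finset.mem_sdiff, Finset.mem_biUnion, Finset.mem_filter]
  constructor
  · rintro ⟨⟨x, hx, -, h⟩, hy⟩
    exact ⟨hy, x, hx, h⟩
  · rintro ⟨hy, x, hx, h⟩
    exact ⟨⟨x, hx, key x h, h⟩, hy⟩

/-- The solid-on-solid Hamiltonian on `Λ` with boundary condition `n`. -/
noncomputable def hamiltonian {d : ℕ} (Λ : Finset (Fin d → ℤ)) (n : ℤ) (φ : Λ → ℤ) : ℝ :=
  (1 / 2 : ℝ) * (∑ x : Λ, ∑ y : Λ, if Adj x.1 y.1 then |(φ x : ℝ) - (φ y : ℝ)| else 0)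
    + ∑ x : Λ, ∑ y ∈ boundary Λ, if Adj x.1 y then |(φ x : ℝ) - (n : ℝ)| else 0

/-- The number of sites of `Λ` at height `0`. -/
def contacts {d : ℕ} {Λ : Finset (Fin d → ℤ)} (φ : Λ → ℤ) : ℕ :=
  (Finset.univ.filter fun x => φ x = 0).card

/-- The partition function of the model without interaction (boundary condition `n`).
For `β > 0` and `d ≥ 1` the series converges. -/
noncomputable def partitionSOS {d : ℕ} (Λ : Finset (Fin d → ℤ)) (β : ℝ) (n : ℤ) : ℝ :=
  ∑' φ : Λ → ℤ, Real.exp (-β * hamiltonian Λ n φ)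

/-- The partition function of the model with homogeneous interaction of intensity `h` at
level `0` (boundary condition `n`). -/
noncomputable def partition {d : ℕ} (Λ : Finset (Fin d → ℤ)) (β : ℝ) (n : ℤ) (h : ℝ) : ℝ :=
  ∑' φ : Λ → ℤ, Real.exp (-β * hamiltonian Λ n φ + h * (contacts φ : ℝ))

/-- The box `{1, …, N}^d`. -/
noncomputable def box (d N : ℕ) : Finset (Fin d → ℤ) := Finset.Icc (fun _ => 1) (fun _ => (N : ℤ))

/-- The free energy of the model without interaction. -/
noncomputable def freeEnergySOS (d : ℕ) (β : ℝ) : ℝ :=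
  Filter.limUnder Filter.atTop
    fun N : ℕ => Real.log (partitionSOS (box d N) β 0) / (N : ℝ) ^ d

/-- The free energy of the model with homogeneous interaction. -/
noncomputable def freeEnergy (d : ℕ) (β h : ℝ) : ℝ :=
  Filter.limUnder Filter.atTop
    fun N : ℕ => Real.log (partition (box d N) β 0 h) / (N : ℝ) ^ d

/-- The free energy difference produced by the interaction. -/
noncomputable def reducedFreeEnergy (d : ℕ) (β h : ℝ) : ℝ :=
  freeEnergy d β h - freeEnergySOS d β

/-- The critical point `inf {h ∈ ℝ : reduced free energy > 0}`, as an extended real number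
(so that it is `⊤` if the set is empty and `⊥` if it is not bounded below). -/
noncomputable def criticalPoint (d : ℕ) (β : ℝ) : EReal :=
  sInf {u : EReal | ∃ h : ℝ, u = (h : EReal) ∧ 0 < reducedFreeEnergy d β h}

/-- The extension of a configuration on `Λ` to `ℤ^d` by the boundary value `0`. -/
def extend {d : ℕ} {Λ : Finset (Fin d → ℤ)} (φ : Λ → ℤ) : (Fin d → ℤ) → ℤ :=
  fun x => if hx : x ∈ Λ then φ ⟨x, hx⟩ else 0

/-- The expectation of `f` under the solid-on-solid measure on `Λ` with boundary condition `0`. -/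
noncomputable def expectation {d : ℕ} (Λ : Finset (Fin d → ℤ)) (β : ℝ)
    (f : ((Fin d → ℤ) → ℤ) → ℝ) : ℝ :=
  (∑' φ : Λ → ℤ, f (extend φ) * Real.exp (-β * hamiltonian Λ 0 φ)) / partitionSOS Λ β 0

/-- The `ℓ¹` distance between two finite sets (a minimum if both are non-empty). -/
noncomputable def setDist {d : ℕ} (A B : Finset (Fin d → ℤ)) : ℕ :=
  sInf {k : ℕ | ∃ x ∈ A, ∃ y ∈ B, k = l1dist x y}

/-- `β₀` is a rigidity threshold: for `β > β₀` the finite volume measures with boundary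
condition `0` converge exponentially fast, on functions of finitely many heights, to a
probability measure on `ℤ^(ℤ^d)`.  (As the right-hand side is monotone in `A`, asking for
this for all `f` depending on the heights in `A` only, or for all `f` whose support is exactly
`A`, is the same. Such an `f` is automatically measurable.) -/
def IsRigidityThreshold (d : ℕ) (β₀ : ℝ) : Prop :=
  0 < β₀ ∧ ∃ c : ℝ, 0 < c ∧ ∀ β : ℝ, β₀ < β →
    ∃ P : MeasureTheory.Measure ((Fin d → ℤ) → ℤ), MeasureTheory.IsProbabilityMeasure P ∧
      ∀ (A : Finset (Fin d → ℤ)) (f : ((Fin d → ℤ) → ℤ) → ℝ), A.Nonempty →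
        (∀ φ, f φ ∈ Set.Icc (0 : ℝ) 1) → DependsOn f (A : Set (Fin d → ℤ)) →
        ∀ Λ : Finset (Fin d → ℤ), A ⊆ Λ →
          |expectation Λ β f - ∫ φ, f φ ∂P|
            ≤ (A.card : ℝ) * Real.exp (-(c * β * (setDist (boundary Λ) A : ℝ)))

end SOS

/-!
Superadditivity over boxes gives the limit with boundary condition `0`, and changing the boundary
condition changes the energy by at most a constant times the size of the boundary, which is of
lower order than the volume. For every `n`, Jensen's inequality bounds the reduced free energy at
`h` from below by `h` times the density of zeros under boundary condition `n`, that is, by `h`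
times the density of sites of height `-n` under boundary condition `0`. Averaging over
`-K ≤ n ≤ K` replaces this by `h / (2 * K + 1)` times the density of sites of height at most `K`
in absolute value. As `K → ∞` this shows that the reduced free energy vanishes for `h ≤ 0`; if the
heights are tight, it also gives a linear lower bound for `h ≥ 0`. By convexity there is a right
derivative at `0`, which is then positive, whereas the left derivative is `0`.

Above a rigidity threshold the heights are tight by comparison of finite volumes with the infinite
one. For large `β` they are tight by a Peierls argument: if the height at `x` is positive, then
lowering by one a finite set `U ∋ x` with positive heights along its inner boundary and non-positive
ones along its outer boundary decreases the energy by `|∂U|`. If `|∂U|` is minimal, the boundary is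
connected through plaquettes, as otherwise one of its components would be a cocycle, hence (by the
vanishing of the first cohomology of `ℤ^d` modulo `2`) the boundary of a set, and `x` would lie in
such a set `U` with smaller boundary. Connected contours around `x` are few enough to be summed.
-/

namespace SOS

open Finset Filter Topology

variable {d : ℕ}

section Lattice

/-- The `i`-th coordinate vector of `ℤ^d`. -/
abbrev unitVec (i : Fin d) : Fin d → ℤ := Pi.single i 1

theorem unitVec_injective : Function.Injective (unitVec : Fin d → Fin d → ℤ) := by
  intro i j h
  by_contra hij
  have := congrFun h i
  simp [unitVec, Pi.single_eq_of_ne hij] at this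

theorem ne_add_unitVec_add_unitVec (x : Fin d → ℤ) (i j : Fin d) :
    x ≠ x + unitVec i + unitVec j := by
  intro h
  have hi : x i = x i + 1 + unitVec j i := by simpa using congrFun h i
  have hj : 0 ≤ unitVec j i := (Pi.single_nonneg.2 zero_le_one : 0 ≤ unitVec j) i
  omega

theorem l1dist_comm (x y : Fin d → ℤ) : l1dist x y = l1dist y x :=
  sum_congr rfl fun i _ => by omega

theorem adj_comm {x y : Fin d → ℤ} : Adj x y ↔ Adj y x := by
  rw [Adj, Adj, l1dist_comm]

theorem adj_add_unitVec (x : Fin d → ℤ) (i : Fin d) : Adj x (x + unitVec i) := by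
  have hi : l1dist x (x + unitVec i) = ∑ j, if j = i then 1 else 0 :=
    sum_congr rfl fun j _ => by by_cases h : j = i <;> simp [unitVec, h]
  simpa [Adj] using hi

theorem adj_iff {x y : Fin d → ℤ} :
    Adj x y ↔ ∃ i, y = x + unitVec i ∨ x = y + unitVec i := by
  refine ⟨fun h => ?_, ?_⟩
  · obtain ⟨i, -, hi⟩ : ∃ i ∈ univ, (x i - y i).natAbs ≠ 0 :=
      exists_ne_zero_of_sum_ne_zero (h.trans_ne one_ne_zero)
    have hsum : (x i - y i).natAbs + ∑ j ∈ univ.erase i, (x j - y j).natAbs = 1 :=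
      (add_sum_erase univ (fun j => (x j - y j).natAbs) (mem_univ i)).trans h
    have hother : ∀ j ≠ i, x j = y j := fun j hj => by
      have := sum_eq_zero_iff.1 (show ∑ j ∈ univ.erase i, (x j - y j).natAbs = 0 by omega) j
        (mem_erase.2 ⟨hj, mem_univ j⟩)
      omega
    refine ⟨i, (show y i = x i + 1 ∨ x i = y i + 1 by omega).imp (fun hi => ?_) fun hi => ?_⟩ <;>
    · ext j
      by_cases hj : j = i
      · subst hj; simp [hi]
      · simp [unitVec, Pi.single_eq_of_ne hj, hother j hj]
  · rintro ⟨i, rfl | rfl⟩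
    · exact adj_add_unitVec x i
    · exact adj_comm.1 (adj_add_unitVec y i)

theorem ite_adj_eq_sum (x y : Fin d → ℤ) (g : ℝ) :
    (if Adj x y then g else 0)
      = ∑ i, ((if y = x + unitVec i then g else 0) + if x = y + unitVec i then g else 0) := by
  have hexcl : ∀ (z : Fin d → ℤ) i j, ¬ z = z + unitVec i + unitVec j :=
    ne_add_unitVec_add_unitVec
  by_cases h : Adj x y
  · obtain ⟨i, rfl | rfl⟩ := adj_iff.1 h <;> simp [h, hexcl, unitVec_injective.eq_iff]
  · have h' : ∀ i, y ≠ x + unitVec i ∧ x ≠ y + unitVec i := by simpa [adj_iff] using h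
    simp [h, h']

theorem add_unitVec_mem {Λ B : Finset (Fin d → ℤ)} (hB : Λ ∪ boundary Λ ⊆ B) {x : Fin d → ℤ}
    (hx : x ∈ Λ) (i : Fin d) : x + unitVec i ∈ B := by
  by_cases h : x + unitVec i ∈ Λ
  · exact hB (mem_union_left _ h)
  · exact hB (mem_union_right _ ((mem_boundary _ _).2 ⟨h, x, hx, adj_add_unitVec x i⟩))

theorem sum_sum_adj_of_symm (B : Finset (Fin d → ℤ)) {F : (Fin d → ℤ) → (Fin d → ℤ) → ℝ}
    (hF : ∀ x y, F x y = F y x) :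
    ∑ x ∈ B, ∑ y ∈ B, (if Adj x y then F x y else 0)
      = 2 * ∑ x ∈ B, ∑ i, if x + unitVec i ∈ B then F x (x + unitVec i) else 0 := by
  have hforward : ∑ x ∈ B, ∑ y ∈ B, ∑ i, (if y = x + unitVec i then F x y else 0)
      = ∑ x ∈ B, ∑ i, if x + unitVec i ∈ B then F x (x + unitVec i) else 0 := by
    refine sum_congr rfl fun x _ => ?_
    rw [sum_comm]
    exact sum_congr rfl fun i _ => sum_ite_eq' B (x + unitVec i) (F x)
  have hbackward : ∑ x ∈ B, ∑ y ∈ B, ∑ i, (if x = y + unitVec i then F x y else 0)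
      = ∑ x ∈ B, ∑ y ∈ B, ∑ i, (if y = x + unitVec i then F x y else 0) := by
    rw [sum_comm]
    simp only [hF]
  simp only [ite_adj_eq_sum, sum_add_distrib]
  rw [hbackward, hforward, two_mul]

end Lattice

theorem sum_sum_eq_of_symm {ι : Type*} [DecidableEq ι] {A B : Finset ι} (hAB : A ⊆ B)
    {F : ι → ι → ℝ} (hF : ∀ x y, F x y = F y x) (hF0 : ∀ x ∉ A, ∀ y ∉ A, F x y = 0) :
    ∑ x ∈ B, ∑ y ∈ B, F x y
      = ∑ x ∈ A, ∑ y ∈ A, F x y + 2 * ∑ x ∈ A, ∑ y ∈ B \ A, F x y := by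
  have houter : ∑ x ∈ B \ A, ∑ y ∈ B \ A, F x y = 0 :=
    sum_eq_zero fun x hx => sum_eq_zero fun y hy =>
      hF0 x (mem_sdiff.1 hx).2 y (mem_sdiff.1 hy).2
  have hcross : ∑ x ∈ B \ A, ∑ y ∈ A, F x y = ∑ x ∈ A, ∑ y ∈ B \ A, F x y := by
    rw [sum_comm]
    simp only [hF]
  rw [← sum_sdiff hAB]
  simp only [← sum_sdiff hAB (f := fun y => F _ y), sum_add_distrib]
  rw [houter, hcross]
  ring

section Hamiltonian

theorem extend_apply {Λ : Finset (Fin d → ℤ)} (φ : Λ → ℤ) (x : Λ) : extend φ x = φ x := by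
  simp [extend]

theorem extend_of_notMem {Λ : Finset (Fin d → ℤ)} (φ : Λ → ℤ) {x : Fin d → ℤ} (hx : x ∉ Λ) :
    extend φ x = 0 := by
  simp [extend, hx]

theorem extend_neg {Λ : Finset (Fin d → ℤ)} (φ : Λ → ℤ) (x : Fin d → ℤ) :
    extend (-φ) x = -extend φ x := by
  by_cases h : x ∈ Λ <;> simp [extend, h]

theorem hamiltonian_eq_sum_extend (Λ : Finset (Fin d → ℤ)) (φ : Λ → ℤ) :
    hamiltonian Λ 0 φ
      = (1 / 2 : ℝ) * ∑ x ∈ Λ, ∑ y ∈ Λ,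
          (if Adj x y then |(extend φ x : ℝ) - extend φ y| else 0)
        + ∑ x ∈ Λ, ∑ y ∈ boundary Λ,
          if Adj x y then |(extend φ x : ℝ) - extend φ y| else 0 := by
  simp only [hamiltonian, ← sum_coe_sort Λ, extend_apply]
  congr! 5 with x _ y hy
  rw [extend_of_notMem φ ((mem_boundary _ _).1 hy).1]

theorem sum_boundary_adj {Λ B : Finset (Fin d → ℤ)} (hB : Λ ∪ boundary Λ ⊆ B)
    {x : Fin d → ℤ} (hx : x ∈ Λ) (g : (Fin d → ℤ) → ℝ) :
    ∑ y ∈ boundary Λ, (if Adj x y then g y else 0)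
      = ∑ y ∈ B \ Λ, if Adj x y then g y else 0 := by
  refine sum_subset (fun y hy => ?_) fun y hy hy' => if_neg fun h => hy' ?_
  · exact mem_sdiff.2 ⟨hB (mem_union_right _ hy), ((mem_boundary _ _).1 hy).1⟩
  · exact (mem_boundary _ _).2 ⟨(mem_sdiff.1 hy).2, x, hx, h⟩

theorem hamiltonian_eq_sum {Λ B : Finset (Fin d → ℤ)} (hB : Λ ∪ boundary Λ ⊆ B) (φ : Λ → ℤ) :
    hamiltonian Λ 0 φ = ∑ y ∈ B, ∑ i, |(extend φ (y + unitVec i) : ℝ) - extend φ y| := by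
  have hΛB : Λ ⊆ B := subset_union_left.trans hB
  have hpairs := sum_sum_eq_of_symm hΛB
    (F := fun x y => if Adj x y then |(extend φ x : ℝ) - extend φ y| else 0)
    (fun x y => by simp only [adj_comm (x := x), abs_sub_comm (extend φ x : ℝ)])
    (fun x hx y hy => by simp [extend_of_notMem φ hx, extend_of_notMem φ hy])
  rw [sum_sum_adj_of_symm B fun x y => abs_sub_comm _ _] at hpairs
  have hbonds : ∑ x ∈ B, ∑ i, (if x + unitVec i ∈ B then
        |(extend φ x : ℝ) - extend φ (x + unitVec i)| else 0)
      = ∑ y ∈ B, ∑ i, |(extend φ (y + unitVec i) : ℝ) - extend φ y| := by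
    refine sum_congr rfl fun x _ => sum_congr rfl fun i _ => ?_
    rw [abs_sub_comm, ite_eq_left_iff]
    intro h
    simp [extend_of_notMem φ fun hx => h (add_unitVec_mem hB hx i),
      extend_of_notMem φ fun hx => h (hΛB hx)]
  rw [hamiltonian_eq_sum_extend, sum_congr rfl fun x hx => sum_boundary_adj hB hx _, ← hbonds]
  linarith

theorem hamiltonian_shift (Λ : Finset (Fin d → ℤ)) (n : ℤ) (φ : Λ → ℤ) :
    hamiltonian Λ n φ = hamiltonian Λ 0 (fun x => φ x - n) := by
  simp [hamiltonian]

theorem hamiltonian_nonneg (Λ : Finset (Fin d → ℤ)) (n : ℤ) (φ : Λ → ℤ) :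
    0 ≤ hamiltonian Λ n φ := by
  unfold hamiltonian
  positivity

theorem hamiltonian_neg (Λ : Finset (Fin d → ℤ)) (φ : Λ → ℤ) :
    hamiltonian Λ 0 (-φ) = hamiltonian Λ 0 φ := by
  simp only [hamiltonian_eq_sum subset_rfl, extend_neg, Int.cast_neg, ← neg_sub', abs_neg]

theorem hamiltonian_zero (Λ : Finset (Fin d → ℤ)) : hamiltonian Λ 0 (0 : Λ → ℤ) = 0 := by
  simp [hamiltonian]

/-- The number of pairs of neighbours made of a site of `Λ` and a site of its boundary, which is
the cost per unit of height of a change of the boundary condition. -/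
noncomputable def boundaryPairs (Λ : Finset (Fin d → ℤ)) : ℝ :=
  ∑ x : Λ, ∑ y ∈ boundary Λ, if Adj x.1 y then (1 : ℝ) else 0

theorem hamiltonian_le_add (Λ : Finset (Fin d → ℤ)) (m n : ℤ) (φ : Λ → ℤ) :
    hamiltonian Λ m φ ≤ hamiltonian Λ n φ + |(m : ℝ) - n| * boundaryPairs Λ := by
  simp only [hamiltonian, boundaryPairs, add_assoc, mul_sum, ← sum_add_distrib]
  gcongr with x _ y _
  split_ifs
  · simpa [abs_sub_comm (n : ℝ) m] using abs_sub_le (φ x : ℝ) n m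
  · simp

end Hamiltonian

section WeightedSums

variable {ι : Type*} {w X : ι → ℝ} {M : ℝ}

theorem summable_mul_of_abs_le (hw : Summable w) (hX : ∀ i, |X i| ≤ M) :
    Summable fun i => X i * w i := by
  refine Summable.of_norm_bounded (hw.abs.mul_left M) fun i => ?_
  rw [Real.norm_eq_abs, abs_mul]
  gcongr
  exact hX i

theorem summable_exp_mul_of_abs_le (hw : Summable w) (hX : ∀ i, |X i| ≤ M) (t : ℝ) :
    Summable fun i => Real.exp (t * X i) * w i := by
  refine summable_mul_of_abs_le (M := Real.exp (|t| * M)) hw fun i => ?_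
  rw [Real.abs_exp, Real.exp_le_exp]
  exact (le_abs_self _).trans (by rw [abs_mul]; gcongr; exact hX i)

theorem log_tsum_add_le_log_tsum_exp_mul (hw0 : ∀ i, 0 ≤ w i) (hw : Summable w)
    (hpos : 0 < ∑' i, w i) (hX : ∀ i, |X i| ≤ M) (t : ℝ) :
    Real.log (∑' i, w i) + t * ((∑' i, X i * w i) / ∑' i, w i)
      ≤ Real.log (∑' i, Real.exp (t * X i) * w i) := by
  have hXw := summable_mul_of_abs_le hw hX
  obtain ⟨m, hm⟩ : ∃ m, m = t * ((∑' i, X i * w i) / ∑' i, w i) := ⟨_, rfl⟩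
  have hmean : t * ∑' i, X i * w i = m * ∑' i, w i := by
    rw [hm]
    field_simp
  have htangent : ∑' i, (Real.exp m * (1 - m) * w i + Real.exp m * t * (X i * w i))
      = Real.exp m * ∑' i, w i := by
    rw [(hw.mul_left _).tsum_add (hXw.mul_left _), tsum_mul_left, tsum_mul_left,
      mul_assoc (Real.exp m) t, hmean]
    ring
  have hle : Real.exp m * ∑' i, w i ≤ ∑' i, Real.exp (t * X i) * w i := by
    rw [← htangent]
    refine ((hw.mul_left _).add (hXw.mul_left _)).tsum_le_tsum (fun i => ?_)
      (summable_exp_mul_of_abs_le hw hX t)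
    have hexp : Real.exp m * (t * X i - m + 1) ≤ Real.exp (t * X i) := by
      calc _ ≤ Real.exp m * Real.exp (t * X i - m) := by
            gcongr
            exact Real.add_one_le_exp _
        _ = _ := by rw [← Real.exp_add, add_sub_cancel]
    linarith [mul_le_mul_of_nonneg_right hexp (hw0 i)]
  have hlog := Real.log_le_log (by positivity) hle
  rw [Real.log_mul (Real.exp_pos m).ne' hpos.ne', Real.log_exp] at hlog
  linarith

theorem convexOn_of_forall_exists_le {f : ℝ → ℝ} (hf : ∀ z, ∃ m, ∀ y, f z + m * (y - z) ≤ f y) :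
    ConvexOn ℝ Set.univ f := by
  refine ⟨convex_univ, fun x _ y _ a b ha hb hab => ?_⟩
  obtain ⟨m, hm⟩ := hf (a • x + b • y)
  have hx := mul_le_mul_of_nonneg_left (hm x) ha
  have hy := mul_le_mul_of_nonneg_left (hm y) hb
  simp only [smul_eq_mul] at hx hy ⊢
  obtain rfl : b = 1 - a := by linarith
  nlinarith

theorem convexOn_log_tsum_exp_mul (hw0 : ∀ i, 0 ≤ w i) (hw : Summable w)
    (hpos : 0 < ∑' i, w i) (hX : ∀ i, |X i| ≤ M) :
    ConvexOn ℝ Set.univ fun t => Real.log (∑' i, Real.exp (t * X i) * w i) := by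
  have hexp := summable_exp_mul_of_abs_le hw hX
  refine convexOn_of_forall_exists_le fun z =>
    ⟨(∑' i, X i * (Real.exp (z * X i) * w i)) / ∑' i, Real.exp (z * X i) * w i, fun y => ?_⟩
  have hposz : 0 < ∑' i, Real.exp (z * X i) * w i := by
    obtain ⟨i, hi⟩ : ∃ i, w i ≠ 0 := by
      by_contra! h
      simp [h] at hpos
    refine (hexp z).tsum_pos (fun i => mul_nonneg (Real.exp_pos _).le (hw0 i)) i ?_
    exact mul_pos (Real.exp_pos _) ((hw0 i).lt_of_ne' hi)
  have h := log_tsum_add_le_log_tsum_exp_mul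
    (fun i => mul_nonneg (Real.exp_pos _).le (hw0 i)) (hexp z) hposz hX (y - z)
  rw [mul_comm (y - z)] at h
  refine h.trans_eq (congrArg Real.log (tsum_congr fun i => ?_))
  rw [← mul_assoc, ← Real.exp_add]
  ring_nf

end WeightedSums

theorem summable_prod_and_tsum_prod_le {ι κ : Type*} [Fintype ι] {g : κ → ℝ} (hg : 0 ≤ g)
    (hs : Summable g) :
    Summable (fun χ : ι → κ => ∏ x, g (χ x)) ∧
      ∑' χ : ι → κ, ∏ x, g (χ x) ≤ (∑' k, g k) ^ Fintype.card ι := by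
  classical
  have hb : ∀ u : Finset (ι → κ), ∑ χ ∈ u, ∏ x, g (χ x) ≤ (∑' k, g k) ^ Fintype.card ι := by
    intro u
    calc ∑ χ ∈ u, ∏ x, g (χ x)
        ≤ ∑ χ ∈ Fintype.piFinset (fun x => u.image (fun χ => χ x)), ∏ x, g (χ x) := by
          refine sum_le_sum_of_subset_of_nonneg (fun χ hχ => ?_) fun _ _ _ => ?_
          · exact Fintype.mem_piFinset.2 fun x => mem_image_of_mem _ hχ
          · exact prod_nonneg fun _ _ => hg _
      _ = ∏ x, ∑ k ∈ u.image (fun χ => χ x), g k := by rw [prod_univ_sum]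
      _ ≤ ∏ _x : ι, ∑' k, g k := by
          gcongr with x
          · exact fun _ _ => sum_nonneg fun _ _ => hg _
          · exact hs.sum_le_tsum _ fun _ _ => hg _
      _ = _ := by simp
  exact ⟨summable_of_sum_le (fun χ => prod_nonneg fun _ _ => hg _) hb,
    Real.tsum_le_of_sum_le (fun χ => prod_nonneg fun _ _ => hg _) hb⟩

theorem summable_exp_neg_abs {β : ℝ} (hβ : 0 < β) :
    Summable fun k : ℤ => Real.exp (-β * |(k : ℝ)|) := by
  have h : Summable fun n : ℕ => Real.exp (-β * (n : ℝ)) := by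
    simpa [mul_comm] using Real.summable_exp_nat_mul_iff.2 (neg_lt_zero.2 hβ)
  apply Summable.of_nat_of_neg <;> simpa using h

section Increments

variable {Λ : Finset (Fin d → ℤ)}

/-- The increments of a configuration in direction `i`. They determine the configuration, which
is how the partition functions are seen to converge. -/
def increments (i : Fin d) (φ : Λ → ℤ) : Λ → ℤ :=
  fun x => extend φ x - extend φ (x - unitVec i)

theorem extend_injective : Function.Injective (extend : (Λ → ℤ) → (Fin d → ℤ) → ℤ) := by
  intro φ φ' h
  ext x
  rw [← extend_apply φ, ← extend_apply φ', h]

theorem increments_injective (i : Fin d) :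
    Function.Injective (increments i : (Λ → ℤ) → Λ → ℤ) := by
  intro φ φ' h
  refine extend_injective (funext fun x => ?_)
  by_contra hx
  have hmem : ∀ y, extend φ y ≠ extend φ' y → y ∈ Λ := by
    intro y hy
    by_contra hy'
    exact hy (by rw [extend_of_notMem φ hy', extend_of_notMem φ' hy'])
  have hall : ∀ k : ℕ, extend φ (x - k • unitVec i) ≠ extend φ' (x - k • unitVec i) := by
    intro k
    induction k with
    | zero => simpa using hx
    | succ k ih =>
      have hk := congrFun h ⟨_, hmem _ ih⟩
      simp only [increments] at hk
      rw [add_smul, one_smul, ← sub_sub]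
      exact fun hc => ih (by linarith)
  have hinj : Function.Injective fun k : ℕ => (⟨_, hmem _ (hall k)⟩ : Λ) := by
    intro k l hkl
    simpa using congrFun (congrArg Subtype.val hkl) i
  exact not_injective_infinite_finite _ hinj

theorem sum_abs_increments_le (i : Fin d) (φ : Λ → ℤ) :
    ∑ x, |(increments i φ x : ℝ)| ≤ hamiltonian Λ 0 φ := by
  classical
  obtain ⟨B, hB⟩ : ∃ B, B = Λ ∪ boundary Λ ∪ Λ.image fun x => x - unitVec i := ⟨_, rfl⟩
  rw [hamiltonian_eq_sum (B := B) (hB ▸ subset_union_left)]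
  calc ∑ x, |(increments i φ x : ℝ)|
      = ∑ x ∈ Λ, |(extend φ x : ℝ) - (extend φ (x - unitVec i) : ℝ)| := by
        rw [← sum_coe_sort Λ]
        simp [increments]
    _ = ∑ y ∈ Λ.image (fun x => x - unitVec i),
          |(extend φ (y + unitVec i) : ℝ) - (extend φ y : ℝ)| := by
        rw [sum_image (fun x _ y _ h => sub_left_injective h)]
        simp
    _ ≤ ∑ y ∈ B, |(extend φ (y + unitVec i) : ℝ) - (extend φ y : ℝ)| :=
        sum_le_sum_of_subset_of_nonneg (hB ▸ subset_union_right) fun _ _ _ => abs_nonneg _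
    _ ≤ _ := sum_le_sum fun y _ => single_le_sum
        (f := fun i => |(extend φ (y + unitVec i) : ℝ) - (extend φ y : ℝ)|)
        (fun _ _ => abs_nonneg _) (mem_univ i)

theorem exp_hamiltonian_le_prod {β : ℝ} (hβ : 0 ≤ β) (i : Fin d) (φ : Λ → ℤ) :
    Real.exp (-β * hamiltonian Λ 0 φ) ≤ ∏ x, Real.exp (-β * |(increments i φ x : ℝ)|) := by
  rw [← Real.exp_sum, ← mul_sum, Real.exp_le_exp, neg_mul, neg_mul, neg_le_neg_iff]
  gcongr
  exact sum_abs_increments_le i φ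

end Increments

section Partition

variable (Λ : Finset (Fin d → ℤ)) (β : ℝ)

theorem partitionSOS_shift (n : ℤ) : partitionSOS Λ β n = partitionSOS Λ β 0 := by
  simp only [partitionSOS, hamiltonian_shift Λ n]
  exact (Equiv.subRight (fun _ : Λ => n)).tsum_eq fun φ => Real.exp (-β * hamiltonian Λ 0 φ)

theorem contacts_le {Λ : Finset (Fin d → ℤ)} (φ : Λ → ℤ) : contacts φ ≤ Λ.card :=
  (card_filter_le _ _).trans (by simp)

theorem abs_contacts_le {Λ : Finset (Fin d → ℤ)} (φ : Λ → ℤ) : |(contacts φ : ℝ)| ≤ Λ.card := by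
  rw [Nat.abs_cast]
  exact_mod_cast contacts_le φ

theorem partition_eq (n : ℤ) (h : ℝ) :
    partition Λ β n h
      = ∑' φ : Λ → ℤ, Real.exp (h * contacts φ) * Real.exp (-β * hamiltonian Λ n φ) :=
  tsum_congr fun φ => by rw [add_comm, Real.exp_add]

theorem partition_zero (n : ℤ) : partition Λ β n 0 = partitionSOS Λ β n := by
  simp [partition, partitionSOS]

/-- The mean number of sites of `Λ` at height `0` under the solid-on-solid measure with boundary
condition `n`. -/
noncomputable def meanContacts (n : ℤ) : ℝ :=
  (∑' φ : Λ → ℤ, (contacts φ : ℝ) * Real.exp (-β * hamiltonian Λ n φ)) / partitionSOS Λ β n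

variable [Nonempty (Fin d)] {β}

theorem summable_exp_hamiltonian (hβ : 0 < β) (n : ℤ) :
    Summable fun φ : Λ → ℤ => Real.exp (-β * hamiltonian Λ n φ) := by
  obtain ⟨i⟩ := ‹Nonempty (Fin d)›
  have hprod := (summable_prod_and_tsum_prod_le (ι := Λ) (fun k => (Real.exp_pos _).le)
    (summable_exp_neg_abs hβ)).1
  have hzero : Summable fun φ : Λ → ℤ => Real.exp (-β * hamiltonian Λ 0 φ) :=
    Summable.of_nonneg_of_le (fun _ => (Real.exp_pos _).le) (exp_hamiltonian_le_prod hβ.le i)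
      (hprod.comp_injective (increments_injective i))
  simp only [hamiltonian_shift Λ n]
  exact (Equiv.subRight (fun _ : Λ => n)).summable_iff.2 hzero

theorem one_le_partitionSOS (hβ : 0 < β) (n : ℤ) : 1 ≤ partitionSOS Λ β n := by
  have h := (summable_exp_hamiltonian Λ hβ 0).le_tsum 0 fun _ _ => (Real.exp_pos _).le
  rw [partitionSOS_shift]
  simpa [hamiltonian_zero, partitionSOS] using h

theorem partitionSOS_pos (hβ : 0 < β) (n : ℤ) : 0 < partitionSOS Λ β n :=
  zero_lt_one.trans_le (one_le_partitionSOS Λ hβ n)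

theorem partitionSOS_le_pow (hβ : 0 < β) (n : ℤ) :
    partitionSOS Λ β n ≤ (∑' k : ℤ, Real.exp (-β * |(k : ℝ)|)) ^ Λ.card := by
  obtain ⟨i⟩ := ‹Nonempty (Fin d)›
  obtain ⟨hprod, hle⟩ := summable_prod_and_tsum_prod_le (ι := Λ) (fun k => (Real.exp_pos _).le)
    (summable_exp_neg_abs hβ)
  have hinj := increments_injective (Λ := Λ) i
  rw [partitionSOS_shift]
  calc partitionSOS Λ β 0
      ≤ ∑' φ : Λ → ℤ, ∏ x, Real.exp (-β * |(increments i φ x : ℝ)|) :=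
        (summable_exp_hamiltonian Λ hβ 0).tsum_le_tsum (exp_hamiltonian_le_prod hβ.le i)
          (hprod.comp_injective hinj)
    _ ≤ ∑' χ : Λ → ℤ, ∏ x, Real.exp (-β * |(χ x : ℝ)|) :=
        tsum_comp_le_tsum_of_inj hprod (fun _ => prod_nonneg fun _ _ => (Real.exp_pos _).le) hinj
    _ ≤ _ := by simpa using hle

theorem summable_partition (hβ : 0 < β) (n : ℤ) (h : ℝ) : Summable fun φ : Λ → ℤ =>
    Real.exp (h * contacts φ) * Real.exp (-β * hamiltonian Λ n φ) :=
  summable_exp_mul_of_abs_le (summable_exp_hamiltonian Λ hβ n) abs_contacts_le h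

theorem exp_mul_card_le_partition (hβ : 0 < β) (h : ℝ) :
    Real.exp (h * Λ.card) ≤ partition Λ β 0 h := by
  rw [partition_eq]
  have := (summable_partition Λ hβ 0 h).le_tsum 0 fun _ _ => by positivity
  simpa [hamiltonian_zero, contacts] using this

theorem partition_pos (hβ : 0 < β) (n : ℤ) (h : ℝ) : 0 < partition Λ β n h := by
  rw [partition_eq]
  exact (summable_partition Λ hβ n h).tsum_pos (fun _ => by positivity) 0 (by positivity)

theorem partition_mono (hβ : 0 < β) (n : ℤ) : Monotone (partition Λ β n) := by
  intro h h' hh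
  rw [partition_eq, partition_eq]
  refine (summable_partition Λ hβ n h).tsum_le_tsum (fun φ => ?_) (summable_partition Λ hβ n h')
  gcongr

theorem partition_le_exp_mul_partitionSOS (hβ : 0 < β) (n : ℤ) (h : ℝ) :
    partition Λ β n h ≤ Real.exp (|h| * Λ.card) * partitionSOS Λ β n := by
  rw [partition_eq, partitionSOS, ← tsum_mul_left]
  refine (summable_partition Λ hβ n h).tsum_le_tsum (fun φ => ?_)
    ((summable_exp_hamiltonian Λ hβ n).mul_left _)
  gcongr
  · exact le_abs_self h
  · exact contacts_le φ

theorem partition_le_exp_mul_partition (hβ : 0 < β) (m n : ℤ) (h : ℝ) :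
    partition Λ β m h
      ≤ Real.exp (β * (|(m : ℝ) - n| * boundaryPairs Λ)) * partition Λ β n h := by
  rw [partition_eq, partition_eq, ← tsum_mul_left]
  refine (summable_partition Λ hβ m h).tsum_le_tsum (fun φ => ?_)
    ((summable_partition Λ hβ n h).mul_left _)
  rw [mul_left_comm, ← Real.exp_add (β * _)]
  gcongr
  have hn := mul_le_mul_of_nonneg_left (hamiltonian_le_add Λ n m φ) hβ.le
  rw [abs_sub_comm] at hn
  linarith

theorem log_partition_le_add_log_partition (hβ : 0 < β) (m n : ℤ) (h : ℝ) :
    Real.log (partition Λ β m h)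
      ≤ β * (|(m : ℝ) - n| * boundaryPairs Λ) + Real.log (partition Λ β n h) := by
  have hlog := Real.log_le_log (partition_pos Λ hβ m h)
    (partition_le_exp_mul_partition Λ hβ m n h)
  rwa [Real.log_mul (Real.exp_pos _).ne' (partition_pos Λ hβ n h).ne', Real.log_exp] at hlog

theorem convexOn_log_partition (hβ : 0 < β) (n : ℤ) :
    ConvexOn ℝ Set.univ fun h => Real.log (partition Λ β n h) := by
  simp only [partition_eq]
  exact convexOn_log_tsum_exp_mul (fun _ => (Real.exp_pos _).le)
    (summable_exp_hamiltonian Λ hβ n) (partitionSOS_pos Λ hβ n) abs_contacts_le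

theorem log_partitionSOS_add_le_log_partition (hβ : 0 < β) (n : ℤ) (h : ℝ) :
    Real.log (partitionSOS Λ β n) + h * meanContacts Λ β n ≤ Real.log (partition Λ β n h) := by
  rw [partition_eq]
  exact log_tsum_add_le_log_tsum_exp_mul (fun _ => (Real.exp_pos _).le)
    (summable_exp_hamiltonian Λ hβ n) (partitionSOS_pos Λ hβ n) abs_contacts_le h

end Partition

section Glue

variable {Λ Λ' : Finset (Fin d → ℤ)}

/-- The configuration on `Λ ∪ Λ'` made of configurations on disjoint sets `Λ` and `Λ'`. -/
def glue (p : (Λ → ℤ) × (Λ' → ℤ)) : (Λ ∪ Λ' : Finset _) → ℤ :=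
  fun x => extend p.1 x + extend p.2 x

theorem extend_glue (p : (Λ → ℤ) × (Λ' → ℤ)) (x : Fin d → ℤ) :
    extend (glue p) x = extend p.1 x + extend p.2 x := by
  by_cases h : x ∈ Λ ∪ Λ'
  · exact extend_apply (glue p) ⟨x, h⟩
  · obtain ⟨hx, hx'⟩ := not_or.1 (mt mem_union.2 h)
    rw [extend_of_notMem _ h, extend_of_notMem _ hx, extend_of_notMem _ hx', add_zero]

theorem glue_injective (hdis : Disjoint Λ Λ') :
    Function.Injective (glue : (Λ → ℤ) × (Λ' → ℤ) → _) := by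
  intro p p' h
  ext x
  · simpa [glue, extend_of_notMem _ (disjoint_left.1 hdis x.2), extend_apply]
      using congrFun h ⟨x, mem_union_left _ x.2⟩
  · simpa [glue, extend_of_notMem _ (disjoint_right.1 hdis x.2), extend_apply]
      using congrFun h ⟨x, mem_union_right _ x.2⟩

theorem contacts_eq_card_filter (φ : Λ → ℤ) :
    contacts φ = (Λ.filter fun x => extend φ x = 0).card := by
  rw [contacts, ← card_map (Function.Embedding.subtype (· ∈ Λ))]
  congr 1
  ext x
  simp only [Finset.mem_map, mem_filter, mem_univ, true_and, Function.Embedding.subtype_apply]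
  constructor
  · rintro ⟨y, hy, rfl⟩
    exact ⟨y.2, by rw [extend_apply, hy]⟩
  · rintro ⟨hx, h0⟩
    exact ⟨⟨x, hx⟩, by rw [← extend_apply φ ⟨x, hx⟩, h0], rfl⟩

theorem contacts_glue (hdis : Disjoint Λ Λ') (p : (Λ → ℤ) × (Λ' → ℤ)) :
    contacts (glue p) = contacts p.1 + contacts p.2 := by
  simp only [contacts_eq_card_filter, extend_glue]
  rw [filter_union, card_union_of_disjoint (disjoint_filter_filter hdis)]
  congr 2
  · refine filter_congr fun x hx => ?_
    rw [extend_of_notMem p.2 (disjoint_left.1 hdis hx), add_zero]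
  · refine filter_congr fun x hx => ?_
    rw [extend_of_notMem p.1 (disjoint_right.1 hdis hx), zero_add]

theorem hamiltonian_glue_le (p : (Λ → ℤ) × (Λ' → ℤ)) :
    hamiltonian (Λ ∪ Λ') 0 (glue p) ≤ hamiltonian Λ 0 p.1 + hamiltonian Λ' 0 p.2 := by
  obtain ⟨B, hB⟩ : ∃ B, B =
      (Λ ∪ boundary Λ) ∪ (Λ' ∪ boundary Λ') ∪ ((Λ ∪ Λ') ∪ boundary (Λ ∪ Λ')) := ⟨_, rfl⟩
  rw [hamiltonian_eq_sum (B := B) (hB ▸ subset_union_right),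
    hamiltonian_eq_sum (B := B) (hB ▸ subset_union_left.trans subset_union_left),
    hamiltonian_eq_sum (B := B) (hB ▸ subset_union_right.trans subset_union_left)]
  simp only [← sum_add_distrib, extend_glue]
  gcongr with y _ i _
  push_cast
  rw [add_sub_add_comm]
  exact abs_add_le _ _

theorem partition_mul_le [Nonempty (Fin d)] (hdis : Disjoint Λ Λ') {β : ℝ} (hβ : 0 < β)
    (h : ℝ) : partition Λ β 0 h * partition Λ' β 0 h ≤ partition (Λ ∪ Λ') β 0 h := by
  have hs := summable_partition Λ hβ 0 h
  have hs' := summable_partition Λ' hβ 0 h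
  have hsu := summable_partition (Λ ∪ Λ') hβ 0 h
  have hprod := hs.mul_of_nonneg hs' (fun _ => by positivity) (fun _ => by positivity)
  have hinj := glue_injective hdis
  rw [partition_eq, partition_eq, partition_eq, hs.tsum_mul_tsum hs' hprod]
  refine le_trans (hprod.tsum_le_tsum (fun p => ?_) (hsu.comp_injective hinj))
    (tsum_comp_le_tsum_of_inj hsu (fun _ => by positivity) hinj)
  simp only [Function.comp_apply, contacts_glue hdis, ← Real.exp_add]
  rw [Real.exp_le_exp, Nat.cast_add]
  linarith [mul_le_mul_of_nonneg_left (hamiltonian_glue_le p) hβ.le]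

end Glue

/-- The logarithm of the partition function, relative to the contribution of the flat
configuration. It is superadditive, nonnegative, and hence monotone in `Λ`, which the logarithm
of the partition function is not for `h < 0`. -/
noncomputable def excess (Λ : Finset (Fin d → ℤ)) (β h : ℝ) : ℝ :=
  Real.log (partition Λ β 0 h) - h * Λ.card

section Excess

variable [Nonempty (Fin d)] {β : ℝ}

theorem excess_nonneg (Λ : Finset (Fin d → ℤ)) (hβ : 0 < β) (h : ℝ) : 0 ≤ excess Λ β h :=
  sub_nonneg.2 <|
    (Real.le_log_iff_exp_le (partition_pos Λ hβ 0 h)).2 (exp_mul_card_le_partition Λ hβ h)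

theorem excess_add_le {Λ Λ' : Finset (Fin d → ℤ)} (hdis : Disjoint Λ Λ') (hβ : 0 < β) (h : ℝ) :
    excess Λ β h + excess Λ' β h ≤ excess (Λ ∪ Λ') β h := by
  have hpos := partition_pos Λ hβ 0 h
  have hpos' := partition_pos Λ' hβ 0 h
  have hlog := Real.log_le_log (mul_pos hpos hpos') (partition_mul_le hdis hβ h)
  rw [Real.log_mul hpos.ne' hpos'.ne'] at hlog
  unfold excess
  rw [card_union_of_disjoint hdis, Nat.cast_add]
  linarith

theorem excess_mono {Λ Λ' : Finset (Fin d → ℤ)} (hsub : Λ ⊆ Λ') (hβ : 0 < β) (h : ℝ) :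
    excess Λ β h ≤ excess Λ' β h := by
  have hadd := excess_add_le (disjoint_sdiff (s := Λ) (t := Λ')) hβ h
  rw [union_sdiff_of_subset hsub] at hadd
  linarith [excess_nonneg (Λ' \ Λ) hβ h]

theorem excess_le_mul_card (Λ : Finset (Fin d → ℤ)) (hβ : 0 < β) (h : ℝ) :
    excess Λ β h
      ≤ (2 * |h| + Real.log (∑' k : ℤ, Real.exp (-β * |(k : ℝ)|))) * Λ.card := by
  have hpos := partitionSOS_pos Λ hβ 0
  have hlog := Real.log_le_log (partition_pos Λ hβ 0 h)
    (partition_le_exp_mul_partitionSOS Λ hβ 0 h)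
  have hlog' := Real.log_le_log hpos (partitionSOS_le_pow Λ hβ 0)
  rw [Real.log_mul (Real.exp_pos _).ne' hpos.ne', Real.log_exp] at hlog
  rw [Real.log_pow] at hlog'
  have habs : -h * (Λ.card : ℝ) ≤ |h| * Λ.card := by
    gcongr
    exact neg_le_abs h
  unfold excess
  linarith

theorem sum_excess_le_excess_biUnion {ι : Type*} (s : Finset ι) (f : ι → Finset (Fin d → ℤ))
    (hdis : (s : Set ι).PairwiseDisjoint f) (hβ : 0 < β) (h : ℝ) :
    ∑ i ∈ s, excess (f i) β h ≤ excess (s.biUnion f) β h := by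
  classical
  induction s using Finset.induction_on with
  | empty => simpa using excess_nonneg ∅ hβ h
  | insert i s hi ih =>
    rw [sum_insert hi, biUnion_insert]
    refine le_trans (add_le_add le_rfl (ih (hdis.subset (by simp)))) (excess_add_le ?_ hβ h)
    rw [disjoint_biUnion_right]
    exact fun j hj => hdis (by simp) (by simp [hj]) (fun hc => hi (hc ▸ hj))

end Excess

/-- The translate of `Λ` by the vector `v`. -/
def translate (Λ : Finset (Fin d → ℤ)) (v : Fin d → ℤ) : Finset (Fin d → ℤ) :=
  Λ.map (Equiv.addRight v).toEmbedding

section Translate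

variable (Λ : Finset (Fin d → ℤ)) (v : Fin d → ℤ)

theorem mem_translate {x : Fin d → ℤ} : x ∈ translate Λ v ↔ x - v ∈ Λ := by
  simp [translate, sub_eq_add_neg]

theorem card_translate : (translate Λ v).card = Λ.card := card_map _

theorem sum_translate (f : (Fin d → ℤ) → ℝ) :
    ∑ y ∈ translate Λ v, f y = ∑ y ∈ Λ, f (y + v) := sum_map _ _ _

theorem card_filter_translate (p : (Fin d → ℤ) → Prop) [DecidablePred p] :
    ((translate Λ v).filter p).card = (Λ.filter fun y => p (y + v)).card := by
  rw [translate, filter_map, card_map]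
  rfl

theorem l1dist_sub_right (x y : Fin d → ℤ) : l1dist (x - v) (y - v) = l1dist x y := by
  simp [l1dist]

theorem adj_sub_right_iff (x y : Fin d → ℤ) : Adj (x - v) (y - v) ↔ Adj x y := by
  rw [Adj, Adj, l1dist_sub_right]

theorem boundary_translate : boundary (translate Λ v) = translate (boundary Λ) v := by
  ext y
  simp only [mem_boundary, mem_translate]
  refine and_congr_right fun _ => ⟨?_, ?_⟩
  · rintro ⟨x, hx, hxy⟩
    exact ⟨x - v, hx, (adj_sub_right_iff v x y).2 hxy⟩
  · rintro ⟨x, hx, hxy⟩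
    refine ⟨x + v, by simpa using hx, (adj_sub_right_iff v _ _).1 ?_⟩
    rwa [add_sub_cancel_right]

/-- Configurations on a translate of `Λ` correspond to configurations on `Λ`. -/
def translateEquiv : (translate Λ v → ℤ) ≃ (Λ → ℤ) :=
  (Equiv.subtypeEquiv (Equiv.addRight v) fun _ => by simp [mem_translate]).symm.arrowCongr
    (Equiv.refl ℤ)

theorem extend_translateEquiv (φ : translate Λ v → ℤ) (x : Fin d → ℤ) :
    extend (translateEquiv Λ v φ) x = extend φ (x + v) := by
  have hmem : x + v ∈ translate Λ v ↔ x ∈ Λ := by simp [mem_translate]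
  by_cases h : x ∈ Λ
  · rw [extend_apply _ (⟨x, h⟩ : Λ), extend_apply _ (⟨x + v, hmem.2 h⟩ : translate Λ v)]
    rfl
  · rw [extend_of_notMem _ h, extend_of_notMem _ (mt hmem.1 h)]

theorem hamiltonian_translateEquiv (φ : translate Λ v → ℤ) :
    hamiltonian Λ 0 (translateEquiv Λ v φ) = hamiltonian (translate Λ v) 0 φ := by
  have hB : translate Λ v ∪ boundary (translate Λ v) = translate (Λ ∪ boundary Λ) v := by
    rw [boundary_translate]
    ext x
    simp [mem_translate]
  rw [hamiltonian_eq_sum subset_rfl, hamiltonian_eq_sum hB.le, sum_translate]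
  simp [extend_translateEquiv, add_right_comm]

theorem contacts_translateEquiv (φ : translate Λ v → ℤ) :
    contacts (translateEquiv Λ v φ) = contacts φ := by
  simp only [contacts_eq_card_filter, card_filter_translate, extend_translateEquiv]

theorem partition_translate (β h : ℝ) :
    partition (translate Λ v) β 0 h = partition Λ β 0 h := by
  unfold partition
  rw [← (translateEquiv Λ v).tsum_eq]
  simp only [hamiltonian_translateEquiv, contacts_translateEquiv]

theorem excess_translate (β h : ℝ) : excess (translate Λ v) β h = excess Λ β h := by
  rw [excess, excess, partition_translate, card_translate]

theorem expectation_translate (β : ℝ) (f : ((Fin d → ℤ) → ℤ) → ℝ) :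
    expectation (translate Λ v) β f = expectation Λ β fun ψ => f fun y => ψ (y - v) := by
  unfold expectation
  rw [← partition_zero, ← partition_zero, partition_translate, ← (translateEquiv Λ v).tsum_eq]
  simp only [hamiltonian_translateEquiv, extend_translateEquiv, sub_add_cancel]

end Translate

section Box

theorem mem_box {N : ℕ} {x : Fin d → ℤ} : x ∈ box d N ↔ ∀ i, 1 ≤ x i ∧ x i ≤ N := by
  simp [box, Pi.le_def, forall_and]

theorem card_box (N : ℕ) : (box d N).card = N ^ d := by
  simp [box, Pi.card_Icc]

theorem pairwise_disjoint_translate_box (M : ℕ) :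
    Pairwise (Function.onFun Disjoint fun k : Fin d → ℤ => translate (box d M) ((M : ℤ) • k)) := by
  intro k l hkl
  refine disjoint_left.2 fun x hx hx' => hkl (funext fun i => ?_)
  have h1 := mem_box.1 ((mem_translate _ _).1 hx) i
  have h2 := mem_box.1 ((mem_translate _ _).1 hx') i
  simp only [Pi.sub_apply, Pi.smul_apply, smul_eq_mul] at h1 h2
  by_contra hne
  rcases lt_or_gt_of_ne hne with hlt | hlt <;> nlinarith

theorem translate_box_subset_box {N M : ℕ} {k : Fin d → ℤ}
    (hk : ∀ i, 0 ≤ k i ∧ k i < (N / M : ℕ)) : translate (box d M) ((M : ℤ) • k) ⊆ box d N := by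
  intro x hx
  refine mem_box.2 fun i => ?_
  have hi := mem_box.1 ((mem_translate _ _).1 hx) i
  simp only [Pi.sub_apply, Pi.smul_apply, smul_eq_mul] at hi
  have hdiv : (M : ℤ) * (N / M : ℕ) ≤ N := by exact_mod_cast Nat.mul_div_le N M
  constructor <;> nlinarith [hk i]

theorem pow_mul_excess_box_le [Nonempty (Fin d)] {β : ℝ} (hβ : 0 < β) (h : ℝ) (N M : ℕ) :
    ((N / M : ℕ) : ℝ) ^ d * excess (box d M) β h ≤ excess (box d N) β h := by
  let cells : Finset (Fin d → ℤ) := Fintype.piFinset fun _ => Finset.Ico (0 : ℤ) (N / M : ℕ)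
  have hsub : cells.biUnion (fun k => translate (box d M) ((M : ℤ) • k)) ⊆ box d N :=
    biUnion_subset.2 fun k hk =>
      translate_box_subset_box fun i => mem_Ico.1 (Fintype.mem_piFinset.1 hk i)
  have hle := (sum_excess_le_excess_biUnion cells _
    ((pairwise_disjoint_translate_box M).set_pairwise _) hβ h).trans (excess_mono hsub hβ h)
  have hcard : cells.card = (N / M) ^ d := by
    simp only [cells, Fintype.card_piFinset, Int.card_Ico, sub_zero, Int.toNat_natCast,
      prod_const, card_univ, Fintype.card_fin]
  simp only [excess_translate, sum_const, hcard, nsmul_eq_mul] at hle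
  exact_mod_cast hle

end Box

theorem tendsto_natCast_div_div (m : ℕ) :
    Tendsto (fun N : ℕ => ((N / m : ℕ) : ℝ) / N) atTop (𝓝 (m : ℝ)⁻¹) := by
  have hfloor := (tendsto_nat_floor_mul_div_atTop (R := ℝ) (a := (m : ℝ)⁻¹) (by positivity)).comp
    tendsto_natCast_atTop_atTop
  refine hfloor.congr fun N => ?_
  rw [Function.comp_apply, inv_mul_eq_div, Nat.floor_div_eq_div]

theorem exists_tendsto_div_pow {a : ℕ → ℝ} {C : ℝ} (hC : ∀ N, a N ≤ C * (N : ℝ) ^ d)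
    (hsup : ∀ N M, ((N / M : ℕ) : ℝ) ^ d * a M ≤ a N) :
    ∃ L, Tendsto (fun N : ℕ => a N / (N : ℝ) ^ d) atTop (𝓝 L) := by
  let densities : Set ℝ := Set.range fun M : ℕ => a (M + 1) / ((M + 1 : ℕ) : ℝ) ^ d
  have hbdd : BddAbove densities := by
    refine ⟨C, ?_⟩
    rintro _ ⟨M, rfl⟩
    exact (div_le_iff₀ (by positivity)).2 (hC (M + 1))
  refine ⟨sSup densities, tendsto_order.2 ⟨fun b hb => ?_, fun b hb => ?_⟩⟩
  · obtain ⟨_, ⟨M, rfl⟩, hM⟩ := exists_lt_of_lt_csSup (Set.range_nonempty _) hb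
    have hlim := ((tendsto_natCast_div_div (M + 1)).pow d).mul_const (a (M + 1))
    rw [inv_pow, inv_mul_eq_div] at hlim
    filter_upwards [(tendsto_order.1 hlim).1 b hM, eventually_gt_atTop 0] with N hN hN0
    refine hN.trans_le ?_
    rw [div_pow, div_mul_eq_mul_div]
    gcongr
    exact hsup N (M + 1)
  · filter_upwards [eventually_gt_atTop 0] with N hN
    obtain ⟨M, rfl⟩ := Nat.exists_eq_succ_of_ne_zero hN.ne'
    exact (le_csSup hbdd ⟨M, rfl⟩).trans_lt hb

/-- The sites of the box `{1, …, N}^d` at depth at least `R`, where the outermost layer has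
depth `0`. -/
noncomputable def bulk (d N R : ℕ) : Finset (Fin d → ℤ) :=
  Finset.Icc (fun _ => 1 + (R : ℤ)) (fun _ => (N : ℤ) - R)

section Bulk

theorem mem_bulk {N R : ℕ} {x : Fin d → ℤ} :
    x ∈ bulk d N R ↔ ∀ i, 1 + (R : ℤ) ≤ x i ∧ x i ≤ N - R := by
  simp [bulk, Pi.le_def, forall_and]

theorem card_bulk (N R : ℕ) : (bulk d N R).card = (N - 2 * R) ^ d := by
  have hside : ((N : ℤ) - R + 1 - (1 + (R : ℤ))).toNat = N - 2 * R := by omega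
  simp [bulk, Pi.card_Icc, hside]

theorem bulk_subset_box (N R : ℕ) : bulk d N R ⊆ box d N := by
  intro x hx
  refine mem_box.2 fun i => ?_
  have := mem_bulk.1 hx i
  omega

theorem tendsto_card_bulk (R : ℕ) :
    Tendsto (fun N : ℕ => ((bulk d N R).card : ℝ) / (N : ℝ) ^ d) atTop (𝓝 1) := by
  have hratio : Tendsto (fun N : ℕ => (2 * R : ℝ) / N) atTop (𝓝 0) :=
    tendsto_const_nhds.div_atTop tendsto_natCast_atTop_atTop
  have hlim : Tendsto (fun N : ℕ => (1 - (2 * R : ℝ) / N) ^ d) atTop (𝓝 1) := by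
    simpa using (hratio.const_sub 1).pow d
  refine hlim.congr' ?_
  filter_upwards [eventually_gt_atTop (2 * R)] with N hN
  have hN0 : (N : ℝ) ≠ 0 := Nat.cast_ne_zero.2 (Nat.ne_zero_of_lt hN)
  rw [card_bulk, Nat.cast_pow, Nat.cast_sub hN.le, ← div_pow, sub_div, div_self hN0,
    Nat.cast_mul, Nat.cast_two]

theorem natAbs_sub_le_l1dist (x y : Fin d → ℤ) (i : Fin d) :
    (x i - y i).natAbs ≤ l1dist x y :=
  single_le_sum (f := fun i => (x i - y i).natAbs) (fun _ _ => Nat.zero_le _) (mem_univ i)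

theorem mem_box_of_mem_bulk {N R : ℕ} {x y : Fin d → ℤ} (hx : x ∈ bulk d N R)
    (hxy : l1dist x y ≤ R) : y ∈ box d N := by
  refine mem_box.2 fun i => ?_
  have hi := mem_bulk.1 hx i
  have hdist := natAbs_sub_le_l1dist x y i
  omega

theorem sum_ite_adj_le (x : Fin d → ℤ) (S : Finset (Fin d → ℤ)) :
    ∑ y ∈ S, (if Adj x y then (1 : ℝ) else 0) ≤ 2 * d := by
  have hdir : ∀ i : Fin d, ∑ y ∈ S, ((if y = x + unitVec i then (1 : ℝ) else 0)
      + if x = y + unitVec i then 1 else 0) ≤ 2 := by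
    intro i
    have hiff : ∀ y, x = y + unitVec i ↔ y = x - unitVec i := fun y =>
      eq_comm.trans eq_sub_iff_add_eq.symm
    simp only [sum_add_distrib, hiff, sum_ite_eq']
    split_ifs <;> norm_num
  simp only [ite_adj_eq_sum]
  rw [sum_comm]
  calc _ ≤ ∑ _i : Fin d, (2 : ℝ) := sum_le_sum fun i _ => hdir i
    _ = 2 * d := by simp [mul_comm]

theorem boundaryPairs_nonneg (Λ : Finset (Fin d → ℤ)) : 0 ≤ boundaryPairs Λ := by
  unfold boundaryPairs
  positivity

theorem boundaryPairs_box_le (N : ℕ) :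
    boundaryPairs (box d N) ≤ 2 * d * ((N : ℝ) ^ d - (bulk d N 1).card) := by
  have hbulk : ∑ x ∈ bulk d N 1, ∑ y ∈ boundary (box d N), (if Adj x y then (1 : ℝ) else 0)
      = 0 := by
    refine sum_eq_zero fun x hx => sum_eq_zero fun y hy => if_neg fun h => ?_
    exact ((mem_boundary _ _).1 hy).1 (mem_box_of_mem_bulk hx (le_of_eq h))
  calc boundaryPairs (box d N)
      = ∑ x ∈ box d N \ bulk d N 1, ∑ y ∈ boundary (box d N), if Adj x y then (1 : ℝ) else 0 := by
        rw [boundaryPairs, sum_coe_sort (box d N)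
          (fun x => ∑ y ∈ boundary (box d N), if Adj x y then (1 : ℝ) else 0),
          ← sum_sdiff (bulk_subset_box N 1), hbulk, add_zero]
    _ ≤ ∑ _x ∈ box d N \ bulk d N 1, (2 * d : ℝ) := sum_le_sum fun x _ => sum_ite_adj_le x _
    _ = 2 * d * ((N : ℝ) ^ d - (bulk d N 1).card) := by
        rw [sum_const, card_sdiff_of_subset (bulk_subset_box N 1), nsmul_eq_mul,
          Nat.cast_sub (card_le_card (bulk_subset_box N 1)), card_box, Nat.cast_pow, mul_comm]

theorem tendsto_boundaryPairs_box (d : ℕ) :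
    Tendsto (fun N : ℕ => boundaryPairs (box d N) / (N : ℝ) ^ d) atTop (𝓝 0) := by
  have hlim : Tendsto (fun N : ℕ => 2 * (d : ℝ) * (1 - ((bulk d N 1).card : ℝ) / (N : ℝ) ^ d))
      atTop (𝓝 0) := by
    simpa using ((tendsto_card_bulk (d := d) 1).const_sub 1).const_mul (2 * (d : ℝ))
  refine squeeze_zero' (Eventually.of_forall fun N =>
    div_nonneg (boundaryPairs_nonneg _) (by positivity)) ?_ hlim
  filter_upwards [eventually_gt_atTop 0] with N hN
  have hN' : (0 : ℝ) < (N : ℝ) ^ d := by positivity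
  rw [div_le_iff₀ hN', mul_assoc, sub_mul, div_mul_cancel₀ _ hN'.ne', one_mul]
  exact boundaryPairs_box_le N

end Bulk

section FreeEnergy

theorem freeEnergySOS_eq (d : ℕ) (β : ℝ) : freeEnergySOS d β = freeEnergy d β 0 := by
  simp only [freeEnergySOS, freeEnergy, partition_zero]

variable [Nonempty (Fin d)] {β : ℝ}

theorem exists_tendsto_log_partition_zero (hβ : 0 < β) (h : ℝ) :
    ∃ L, Tendsto (fun N : ℕ => Real.log (partition (box d N) β 0 h) / (N : ℝ) ^ d) atTop
      (𝓝 L) := by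
  obtain ⟨L, hL⟩ := exists_tendsto_div_pow (a := fun N => excess (box d N) β h) (d := d)
    (C := 2 * |h| + Real.log (∑' k : ℤ, Real.exp (-β * |(k : ℝ)|)))
    (fun N => by simpa [card_box] using excess_le_mul_card (box d N) hβ h)
    (fun N M => pow_mul_excess_box_le hβ h N M)
  refine ⟨L + h, (hL.add_const h).congr' ?_⟩
  filter_upwards [eventually_gt_atTop 0] with N hN
  have hN' : (N : ℝ) ^ d ≠ 0 := by positivity
  rw [excess, card_box, Nat.cast_pow, sub_div, mul_div_cancel_right₀ _ hN', sub_add_cancel]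

theorem abs_log_partition_sub_le (Λ : Finset (Fin d → ℤ)) (hβ : 0 < β) (m n : ℤ) (h : ℝ) :
    |Real.log (partition Λ β m h) - Real.log (partition Λ β n h)|
      ≤ β * (|(m : ℝ) - n| * boundaryPairs Λ) := by
  have hmn := log_partition_le_add_log_partition Λ hβ m n h
  have hnm := log_partition_le_add_log_partition Λ hβ n m h
  rw [abs_sub_comm] at hnm
  exact abs_sub_le_iff.2 ⟨by linarith, by linarith⟩

theorem tendsto_log_partition (hβ : 0 < β) (n : ℤ) (h : ℝ) :
    Tendsto (fun N : ℕ => Real.log (partition (box d N) β n h) / (N : ℝ) ^ d) atTop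
      (𝓝 (freeEnergy d β h)) := by
  have hzero : Tendsto (fun N : ℕ => Real.log (partition (box d N) β 0 h) / (N : ℝ) ^ d) atTop
      (𝓝 (freeEnergy d β h)) := tendsto_nhds_limUnder (exists_tendsto_log_partition_zero hβ h)
  have hsurface : Tendsto (fun N : ℕ => (Real.log (partition (box d N) β n h)
      - Real.log (partition (box d N) β 0 h)) / (N : ℝ) ^ d) atTop (𝓝 0) := by
    have hlim := (tendsto_boundaryPairs_box d).const_mul (β * |(n : ℝ)|)
    rw [mul_zero] at hlim
    refine squeeze_zero_norm (fun N => ?_) hlim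
    rw [norm_div, Real.norm_eq_abs, Real.norm_of_nonneg (by positivity), ← mul_div_assoc]
    gcongr
    simpa [mul_assoc] using abs_log_partition_sub_le (box d N) hβ n 0 h
  simpa only [← add_div, sub_add_cancel, zero_add] using hsurface.add hzero

theorem tendsto_log_partitionSOS (hβ : 0 < β) (n : ℤ) :
    Tendsto (fun N : ℕ => Real.log (partitionSOS (box d N) β n) / (N : ℝ) ^ d) atTop
      (𝓝 (freeEnergySOS d β)) := by
  simpa [freeEnergySOS_eq, partition_zero] using tendsto_log_partition (d := d) hβ n 0

end FreeEnergy

/-- The indicator function of the event that the height at `x` is at most `K` in absolute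
value. -/
def heightIndicator (K : ℕ) (x : Fin d → ℤ) (ψ : (Fin d → ℤ) → ℤ) : ℝ :=
  if |ψ x| ≤ K then 1 else 0

theorem heightIndicator_mem_Icc (K : ℕ) (x : Fin d → ℤ) (ψ : (Fin d → ℤ) → ℤ) :
    heightIndicator K x ψ ∈ Set.Icc (0 : ℝ) 1 := by
  unfold heightIndicator
  split_ifs <;> simp

theorem sum_ite_eq_neg_eq_heightIndicator (K : ℕ) (x : Fin d → ℤ) (ψ : (Fin d → ℤ) → ℤ) :
    ∑ n ∈ Finset.Icc (-(K : ℤ)) K, (if ψ x = -n then (1 : ℝ) else 0)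
      = heightIndicator K x ψ := by
  have hiff : ∀ n, ψ x = -n ↔ n = -ψ x := fun n => by omega
  simp only [hiff, sum_ite_eq', heightIndicator, Finset.mem_Icc, abs_le]
  exact if_congr (by omega) rfl rfl

section Expectation

variable (Λ : Finset (Fin d → ℤ)) (β : ℝ)

theorem meanContacts_eq_expectation (n : ℤ) :
    meanContacts Λ β n
      = expectation Λ β fun ψ => ∑ x ∈ Λ, if ψ x = -n then (1 : ℝ) else 0 := by
  unfold meanContacts expectation
  rw [partitionSOS_shift, ← (Equiv.addRight (fun _ : Λ => n)).tsum_eq]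
  congr 2 with φ
  congr 1
  · simp only [← sum_coe_sort Λ, extend_apply, contacts, sum_boole, Equiv.coe_addRight,
      Pi.add_apply, ← eq_neg_iff_add_eq_zero]
  · simp [hamiltonian_shift Λ n]

variable [Nonempty (Fin d)] {β}

theorem expectation_sum (hβ : 0 < β) {ι : Type*} (s : Finset ι) (f : ι → ((Fin d → ℤ) → ℤ) → ℝ)
    {M : ℝ} (hf : ∀ i ψ, |f i ψ| ≤ M) :
    expectation Λ β (fun ψ => ∑ i ∈ s, f i ψ) = ∑ i ∈ s, expectation Λ β (f i) := by
  unfold expectation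
  rw [← sum_div, ← Summable.tsum_finsetSum fun i _ =>
    summable_mul_of_abs_le (summable_exp_hamiltonian Λ hβ 0) fun φ => hf i (extend φ)]
  simp only [sum_mul]

theorem expectation_add (hβ : 0 < β) {f g : ((Fin d → ℤ) → ℤ) → ℝ} {M M' : ℝ}
    (hf : ∀ ψ, |f ψ| ≤ M) (hg : ∀ ψ, |g ψ| ≤ M') :
    expectation Λ β (fun ψ => f ψ + g ψ) = expectation Λ β f + expectation Λ β g := by
  have hs := summable_exp_hamiltonian Λ hβ 0
  unfold expectation
  rw [← add_div, ← (summable_mul_of_abs_le hs fun φ => hf _).tsum_add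
    (summable_mul_of_abs_le hs fun φ => hg _)]
  simp only [add_mul]

theorem expectation_mono (hβ : 0 < β) {f g : ((Fin d → ℤ) → ℤ) → ℝ} {M : ℝ}
    (hf : ∀ ψ, |f ψ| ≤ M) (hg : ∀ ψ, |g ψ| ≤ M) (hfg : ∀ ψ, f ψ ≤ g ψ) :
    expectation Λ β f ≤ expectation Λ β g := by
  have hs := summable_exp_hamiltonian Λ hβ 0
  refine div_le_div_of_nonneg_right (Summable.tsum_le_tsum (fun φ => ?_)
    (summable_mul_of_abs_le hs fun φ => hf _) (summable_mul_of_abs_le hs fun φ => hg _))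
    (partitionSOS_pos Λ hβ 0).le
  gcongr
  exact hfg _

theorem expectation_const (hβ : 0 < β) (a : ℝ) : expectation Λ β (fun _ => a) = a := by
  unfold expectation
  rw [tsum_mul_left]
  exact mul_div_cancel_right₀ a (partitionSOS_pos Λ hβ 0).ne'

theorem expectation_mem_Icc (hβ : 0 < β) {f : ((Fin d → ℤ) → ℤ) → ℝ}
    (hf : ∀ ψ, f ψ ∈ Set.Icc (0 : ℝ) 1) : expectation Λ β f ∈ Set.Icc (0 : ℝ) 1 := by
  have hbdd : ∀ ψ, |f ψ| ≤ 1 := fun ψ => abs_le.2 ⟨by linarith [(hf ψ).1], (hf ψ).2⟩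
  constructor
  · rw [← expectation_const Λ hβ 0]
    exact expectation_mono Λ hβ (by simp) hbdd fun ψ => (hf ψ).1
  · conv_rhs => rw [← expectation_const Λ hβ 1]
    exact expectation_mono Λ hβ hbdd (by simp) fun ψ => (hf ψ).2

theorem sum_meanContacts (hβ : 0 < β) (K : ℕ) :
    ∑ n ∈ Finset.Icc (-(K : ℤ)) K, meanContacts Λ β n
      = ∑ x ∈ Λ, expectation Λ β (heightIndicator K x) := by
  have hbdd : ∀ (x : Fin d → ℤ) (n : ℤ) (ψ : (Fin d → ℤ) → ℤ),
      |if ψ x = -n then (1 : ℝ) else 0| ≤ 1 := by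
    intro x n ψ
    split_ifs <;> simp
  simp only [meanContacts_eq_expectation, expectation_sum Λ hβ Λ _ fun x => hbdd x _]
  rw [sum_comm]
  refine sum_congr rfl fun x _ => ?_
  rw [← expectation_sum Λ hβ _ _ (hbdd x)]
  simp only [sum_ite_eq_neg_eq_heightIndicator]

theorem mul_sum_expectation_heightIndicator_le (hβ : 0 < β) (h : ℝ) (K : ℕ) :
    h * ∑ x ∈ Λ, expectation Λ β (heightIndicator K x)
      ≤ (2 * K + 1) * (Real.log (partition Λ β 0 h) - Real.log (partitionSOS Λ β 0)
        + β * K * boundaryPairs Λ) := by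
  have hn : ∀ n ∈ Finset.Icc (-(K : ℤ)) K, h * meanContacts Λ β n
      ≤ Real.log (partition Λ β 0 h) - Real.log (partitionSOS Λ β 0)
        + β * K * boundaryPairs Λ := by
    intro n hn
    have hnK : |(n : ℝ) - (0 : ℤ)| ≤ K := by
      rw [Int.cast_zero, sub_zero]
      exact_mod_cast abs_le.2 (Finset.mem_Icc.1 hn)
    have hmean := log_partitionSOS_add_le_log_partition Λ hβ n h
    have hbc := log_partition_le_add_log_partition Λ hβ n 0 h
    have hcost := mul_le_mul_of_nonneg_left
      (mul_le_mul_of_nonneg_right hnK (boundaryPairs_nonneg Λ)) hβ.le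
    rw [partitionSOS_shift] at hmean
    linarith
  have hcard : ((Finset.Icc (-(K : ℤ)) K).card : ℝ) = 2 * K + 1 := by
    rw [Int.card_Icc, show ((K : ℤ) + 1 - -K).toNat = 2 * K + 1 by omega]
    push_cast
    rfl
  rw [← sum_meanContacts Λ hβ, mul_sum, ← hcard, ← nsmul_eq_mul]
  exact sum_le_card_nsmul _ _ _ hn

end Expectation

/-- Inside the boxes the heights are bounded by a constant with a probability bounded away
from `0`. -/
def IsTight (d : ℕ) (β : ℝ) : Prop :=
  ∃ (K R : ℕ) (δ : ℝ), 0 < δ ∧ ∀ N : ℕ, ∀ x ∈ bulk d N R,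
    δ ≤ expectation (box d N) β (heightIndicator K x)

section ReducedFreeEnergy

theorem reducedFreeEnergy_zero (d : ℕ) (β : ℝ) : reducedFreeEnergy d β 0 = 0 := by
  rw [reducedFreeEnergy, freeEnergySOS_eq, sub_self]

variable [Nonempty (Fin d)] {β : ℝ}

theorem tendsto_reducedFreeEnergy (hβ : 0 < β) (h : ℝ) :
    Tendsto (fun N : ℕ => (Real.log (partition (box d N) β 0 h)
      - Real.log (partitionSOS (box d N) β 0)) / (N : ℝ) ^ d) atTop
      (𝓝 (reducedFreeEnergy d β h)) := by
  simp only [sub_div]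
  exact (tendsto_log_partition hβ 0 h).sub (tendsto_log_partitionSOS hβ 0)

theorem reducedFreeEnergy_mono (hβ : 0 < β) : Monotone (reducedFreeEnergy d β) := by
  intro h h' hh
  refine le_of_tendsto_of_tendsto' (tendsto_reducedFreeEnergy hβ h)
    (tendsto_reducedFreeEnergy hβ h') fun N => ?_
  have := partition_pos (box d N) hβ 0 h
  gcongr
  exact partition_mono (box d N) hβ 0 hh

theorem convexOn_reducedFreeEnergy (hβ : 0 < β) :
    ConvexOn ℝ Set.univ (reducedFreeEnergy d β) := by
  refine isClosed_setOfPred_convexOn.mem_of_tendsto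
    (tendsto_pi_nhds.2 (tendsto_reducedFreeEnergy (d := d) hβ)) (Eventually.of_forall fun N => ?_)
  have hconvex := ((convexOn_log_partition (box d N) hβ 0).add_const
    (-Real.log (partitionSOS (box d N) β 0))).smul (inv_nonneg.2 (by positivity : 0 ≤ (N : ℝ) ^ d))
  simp only [Pi.add_apply, smul_eq_mul, ← sub_eq_add_neg, inv_mul_eq_div] at hconvex
  exact hconvex

theorem mul_le_mul_reducedFreeEnergy (hβ : 0 < β) {h ρ : ℝ} {K : ℕ} {a : ℕ → ℝ}
    (ha : Tendsto (fun N : ℕ => a N / (N : ℝ) ^ d) atTop (𝓝 ρ))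
    (hle : ∀ N, h * a N ≤ h * ∑ x ∈ box d N, expectation (box d N) β (heightIndicator K x)) :
    h * ρ ≤ (2 * K + 1) * reducedFreeEnergy d β h := by
  have hlim := ((tendsto_reducedFreeEnergy (d := d) hβ h).add
    ((tendsto_boundaryPairs_box d).const_mul (β * K))).const_mul (2 * (K : ℝ) + 1)
  rw [mul_zero, add_zero] at hlim
  refine le_of_tendsto_of_tendsto' (ha.const_mul h) hlim fun N => ?_
  rw [← mul_div_assoc, ← mul_div_assoc, ← add_div, ← mul_div_assoc]
  refine div_le_div_of_nonneg_right ?_ (by positivity)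
  exact (hle N).trans (mul_sum_expectation_heightIndicator_le (box d N) hβ h K)

theorem reducedFreeEnergy_nonneg (hβ : 0 < β) (h : ℝ) : 0 ≤ reducedFreeEnergy d β h := by
  rcases le_or_gt 0 h with hh | hh
  · rw [← reducedFreeEnergy_zero d β]
    exact reducedFreeEnergy_mono hβ hh
  have hdensity : ∀ K : ℕ, h * 1 ≤ (2 * K + 1) * reducedFreeEnergy d β h := by
    intro K
    refine mul_le_mul_reducedFreeEnergy hβ (tendsto_card_bulk 0) fun N =>
      mul_le_mul_of_nonpos_left ?_ hh.le
    calc ∑ x ∈ box d N, expectation (box d N) β (heightIndicator K x)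
        ≤ ∑ _x ∈ box d N, (1 : ℝ) := sum_le_sum fun x _ =>
          (expectation_mem_Icc (box d N) hβ (heightIndicator_mem_Icc K x)).2
      _ = (bulk d N 0).card := by simp [card_box, card_bulk]
  by_contra! hneg
  obtain ⟨K, hK⟩ := exists_nat_gt (h / reducedFreeEnergy d β h)
  rw [div_lt_iff_of_neg hneg] at hK
  linarith [hdensity K, mul_nonpos_of_nonneg_of_nonpos (Nat.cast_nonneg' (α := ℝ) K) hneg.le]

theorem reducedFreeEnergy_of_nonpos (hβ : 0 < β) {h : ℝ} (hh : h ≤ 0) :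
    reducedFreeEnergy d β h = 0 := by
  refine le_antisymm ?_ (reducedFreeEnergy_nonneg hβ h)
  rw [← reducedFreeEnergy_zero d β]
  exact reducedFreeEnergy_mono hβ hh

theorem IsTight.exists_mul_le (hβ : 0 < β) (ht : IsTight d β) :
    ∃ κ : ℝ, 0 < κ ∧ ∀ h, 0 ≤ h → κ * h ≤ reducedFreeEnergy d β h := by
  obtain ⟨K, R, δ, hδ, hx⟩ := ht
  refine ⟨δ / (2 * K + 1), by positivity, fun h hh => ?_⟩
  have hlim : Tendsto (fun N : ℕ => δ * (bulk d N R).card / (N : ℝ) ^ d) atTop (𝓝 δ) := by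
    simpa [mul_div_assoc] using (tendsto_card_bulk (d := d) R).const_mul δ
  have hle := mul_le_mul_reducedFreeEnergy (h := h) (K := K) hβ hlim fun N =>
    mul_le_mul_of_nonneg_left ?_ hh
  · rw [div_mul_eq_mul_div, div_le_iff₀ (by positivity)]
    linarith
  · calc δ * (bulk d N R).card = ∑ _x ∈ bulk d N R, δ := by rw [sum_const, nsmul_eq_mul, mul_comm]
      _ ≤ ∑ x ∈ bulk d N R, expectation (box d N) β (heightIndicator K x) := sum_le_sum (hx N)
      _ ≤ _ := sum_le_sum_of_subset_of_nonneg (bulk_subset_box N R) fun x _ _ =>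
          (expectation_mem_Icc (box d N) hβ (heightIndicator_mem_Icc K x)).1

theorem criticalPoint_eq_zero (hβ : 0 < β)
    (hpos : ∀ h, 0 < h → 0 < reducedFreeEnergy d β h) : criticalPoint d β = 0 := by
  apply le_antisymm
  · refine EReal.le_of_forall_lt_iff_le.1 fun h hh => ?_
    exact sInf_le ⟨h, rfl, hpos h (EReal.coe_pos.1 hh)⟩
  · refine le_sInf ?_
    rintro _ ⟨h, rfl, hh⟩
    contrapose! hh
    exact (reducedFreeEnergy_of_nonpos hβ (EReal.coe_neg'.1 hh).le).le

end ReducedFreeEnergy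

section Transition

variable {F : ℝ → ℝ} {c : ℝ}

theorem exists_pos_hasDerivWithinAt_Ioi (hF : ConvexOn ℝ Set.univ F) (hF0 : F 0 = 0) {κ : ℝ}
    (hκ : 0 < κ) (hκF : ∀ h, 0 ≤ h → κ * h ≤ F h) :
    ∃ c, 0 < c ∧ HasDerivWithinAt F c (Set.Ioi 0) 0 := by
  have hderiv := hF.hasDerivWithinAt_rightDeriv_of_mem_interior (x := 0) (by simp)
  refine ⟨_, hκ.trans_le (ge_of_tendsto
    ((hasDerivWithinAt_iff_tendsto_slope' Set.self_notMem_Ioi).1 hderiv) ?_), hderiv⟩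
  filter_upwards [self_mem_nhdsWithin] with h hh
  rw [slope_def_field, hF0, sub_zero, sub_zero, le_div_iff₀ hh]
  exact hκF h (le_of_lt hh)

theorem isEquivalent_of_hasDerivWithinAt_Ioi (hF0 : F 0 = 0) (hc : c ≠ 0)
    (hderiv : HasDerivWithinAt F c (Set.Ioi 0) 0) :
    Asymptotics.IsEquivalent (𝓝[>] 0) F fun h => c * h := by
  have hlittle := hderiv.isLittleO
  simp only [hF0, sub_zero, smul_eq_mul, mul_comm _ c] at hlittle
  exact (Asymptotics.isLittleO_const_mul_right_iff hc).2 hlittle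

theorem not_differentiableAt_of_hasDerivWithinAt_Ioi (hF0 : ∀ h ≤ 0, F h = 0) (hc : c ≠ 0)
    (hderiv : HasDerivWithinAt F c (Set.Ioi 0) 0) : ¬ DifferentiableAt ℝ F 0 := by
  intro hdiff
  have hright := (uniqueDiffWithinAt_Ioi 0).eq_deriv _ hdiff.hasDerivAt.hasDerivWithinAt hderiv
  have hleft := (uniqueDiffWithinAt_Iio 0).eq_deriv _ hdiff.hasDerivAt.hasDerivWithinAt
    ((hasDerivWithinAt_const 0 (Set.Iio 0) 0).congr (fun h hh => hF0 h (le_of_lt hh))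
      (hF0 0 le_rfl))
  exact hc (hright.symm.trans hleft)

end Transition

/-! ### Tightness above a rigidity threshold -/

section Rigidity

theorem le_l1dist_of_mem_bulk {N R : ℕ} {x y : Fin d → ℤ} (hx : x ∈ bulk d N R)
    (hy : y ∈ boundary (box d N)) : R ≤ l1dist y x := by
  by_contra! hlt
  exact ((mem_boundary _ _).1 hy).1 (mem_box_of_mem_bulk hx (l1dist_comm x y ▸ hlt.le))

variable [Nonempty (Fin d)]

theorem boundary_nonempty {Λ : Finset (Fin d → ℤ)} (hΛ : Λ.Nonempty) :
    (boundary Λ).Nonempty := by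
  obtain ⟨i⟩ := ‹Nonempty (Fin d)›
  obtain ⟨x, hx, hmax⟩ := Λ.exists_max_image (fun x => x i) hΛ
  refine ⟨x + unitVec i, (mem_boundary _ _).2 ⟨fun hmem => ?_, x, hx, adj_add_unitVec x i⟩⟩
  simpa [unitVec] using hmax _ hmem

theorem le_setDist_boundary {Λ : Finset (Fin d → ℤ)} {x : Fin d → ℤ} (hx : x ∈ Λ) {R : ℕ}
    (hR : ∀ y ∈ boundary Λ, R ≤ l1dist y x) : R ≤ setDist (boundary Λ) {x} := by
  obtain ⟨y, hy⟩ := boundary_nonempty ⟨x, hx⟩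
  refine le_csInf ⟨_, y, hy, x, mem_singleton_self x, rfl⟩ ?_
  rintro _ ⟨z, hz, w, hw, rfl⟩
  rw [mem_singleton.1 hw]
  exact hR z hz

variable {β : ℝ}

theorem continuousAt_tsum_mul_exp (Λ : Finset (Fin d → ℤ)) (hβ : 0 < β)
    {F : (Λ → ℤ) → ℝ} {M : ℝ} (hF : ∀ φ, |F φ| ≤ M) :
    ContinuousAt (fun b => ∑' φ : Λ → ℤ, F φ * Real.exp (-b * hamiltonian Λ 0 φ)) β := by
  have hM : 0 ≤ M := (abs_nonneg _).trans (hF 0)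
  refine (continuousOn_tsum (u := fun φ => M * Real.exp (-(β / 2) * hamiltonian Λ 0 φ))
    (fun φ => by fun_prop) ((summable_exp_hamiltonian Λ (half_pos hβ) 0).mul_left M)
    fun φ b hb => ?_).continuousAt (Ioi_mem_nhds (half_lt_self hβ))
  rw [Real.norm_eq_abs, abs_mul, Real.abs_exp]
  have := hamiltonian_nonneg Λ 0 φ
  gcongr
  exacts [hF φ, hb.le]

theorem continuousAt_expectation (Λ : Finset (Fin d → ℤ)) (hβ : 0 < β)
    {f : ((Fin d → ℤ) → ℤ) → ℝ} {M : ℝ} (hf : ∀ ψ, |f ψ| ≤ M) :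
    ContinuousAt (fun b => expectation Λ b f) β := by
  refine (continuousAt_tsum_mul_exp Λ hβ (F := fun φ => f (extend φ)) fun φ => hf _).div ?_
    (partitionSOS_pos Λ hβ 0).ne'
  simpa only [partitionSOS, one_mul] using
    continuousAt_tsum_mul_exp Λ hβ (F := fun _ => 1) (M := 1) (by simp)

theorem tendsto_expectation_heightIndicator (Λ : Finset (Fin d → ℤ)) (hβ : 0 < β)
    (x : Fin d → ℤ) :
    Tendsto (fun K : ℕ => expectation Λ β (heightIndicator K x)) atTop (𝓝 1) := by
  have hlim : Tendsto (fun K : ℕ => ∑' φ : Λ → ℤ,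
      heightIndicator K x (extend φ) * Real.exp (-β * hamiltonian Λ 0 φ)) atTop
      (𝓝 (∑' φ : Λ → ℤ, Real.exp (-β * hamiltonian Λ 0 φ))) := by
    refine tendsto_tsum_of_dominated_convergence (summable_exp_hamiltonian Λ hβ 0)
      (fun φ => ?_) (Eventually.of_forall fun K φ => ?_)
    · refine tendsto_const_nhds.congr' ?_
      filter_upwards [eventually_ge_atTop (extend φ x).natAbs] with K hK
      rw [heightIndicator, if_pos (abs_le.2 (by omega)), one_mul]
    · have hmem := heightIndicator_mem_Icc K x (extend φ)
      rw [Real.norm_eq_abs, abs_mul, Real.abs_exp, abs_of_nonneg hmem.1]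
      exact mul_le_of_le_one_left (Real.exp_pos _).le hmem.2
  have hquot := hlim.div_const (partitionSOS Λ β 0)
  rwa [← partitionSOS, div_self (partitionSOS_pos Λ hβ 0).ne'] at hquot

theorem IsRigidityThreshold.exists_expectation_le_add {β₀ : ℝ}
    (hrig : IsRigidityThreshold d β₀) {ε : ℝ} (hε : 0 < ε) :
    ∃ R : ℕ, ∀ β ≥ β₀, ∀ (x : Fin d → ℤ) (f : ((Fin d → ℤ) → ℤ) → ℝ),
      (∀ ψ, f ψ ∈ Set.Icc (0 : ℝ) 1) → DependsOn f {x} → ∀ Λ Λ' : Finset (Fin d → ℤ),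
        x ∈ Λ → x ∈ Λ' → (∀ y ∈ boundary Λ, R ≤ l1dist y x) →
        (∀ y ∈ boundary Λ', R ≤ l1dist y x) →
        expectation Λ β f ≤ expectation Λ' β f + ε := by
  obtain ⟨hβ₀, c, hc, hP⟩ := hrig
  obtain ⟨R, hR⟩ : ∃ R : ℕ, Real.exp (-(c * β₀ * R)) ≤ ε / 2 :=
    ((Real.tendsto_exp_neg_atTop_nhds_zero.comp
      (tendsto_natCast_atTop_atTop.const_mul_atTop (mul_pos hc hβ₀))).eventually
      (ge_mem_nhds (half_pos hε))).exists
  refine ⟨R, fun β hβ x f hf hdep Λ Λ' hx hx' hΛ hΛ' => ?_⟩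
  have hcont (Λ : Finset (Fin d → ℤ)) : Tendsto (expectation Λ · f) (𝓝[>] β)
      (𝓝 (expectation Λ β f)) :=
    (continuousAt_expectation Λ (hβ₀.trans_le hβ) (M := 1) fun ψ =>
      (abs_of_nonneg (hf ψ).1).trans_le (hf ψ).2).tendsto.mono_left nhdsWithin_le_nhds
  -- The definition only controls `b > β₀`; the value `β = β₀` is reached as a limit.
  refine le_of_tendsto_of_tendsto (hcont Λ) ((hcont Λ').add_const ε) ?_
  filter_upwards [self_mem_nhdsWithin] with b hb
  have hβ₀b : β₀ < b := hβ.trans_lt hb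
  obtain ⟨P, -, hP⟩ := hP b hβ₀b
  have hclose : ∀ Λ : Finset (Fin d → ℤ), x ∈ Λ → (∀ y ∈ boundary Λ, R ≤ l1dist y x) →
      |expectation Λ b f - ∫ φ, f φ ∂P| ≤ ε / 2 := by
    intro Λ hx hΛ
    refine (hP {x} f (singleton_nonempty x) hf (by simpa using hdep) Λ
      (singleton_subset_iff.2 hx)).trans (le_trans ?_ hR)
    rw [card_singleton, Nat.cast_one, one_mul]
    have hcb : 0 ≤ c * b := (mul_pos hc (hβ₀.trans hβ₀b)).le
    gcongr
    exact le_setDist_boundary hx hΛ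
  linarith [(abs_le.1 (hclose Λ hx hΛ)).2, (abs_le.1 (hclose Λ' hx' hΛ')).1]

theorem IsRigidityThreshold.isTight {β₀ : ℝ} (hrig : IsRigidityThreshold d β₀)
    (hβ : β₀ ≤ β) : IsTight d β := by
  obtain ⟨R, hR⟩ := hrig.exists_expectation_le_add (by norm_num : (0 : ℝ) < 1 / 4)
  -- The centre of the box `{1, …, 2 R + 1}^d`.
  let x₀ : Fin d → ℤ := fun _ => R + 1
  have hx₀ : x₀ ∈ bulk d (2 * R + 1) R := mem_bulk.2 fun i => by
    simp only [x₀]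
    omega
  obtain ⟨K, hK⟩ := ((tendsto_expectation_heightIndicator (box d (2 * R + 1))
    (hrig.1.trans_le hβ) x₀).eventually (lt_mem_nhds (by norm_num : (1 / 2 : ℝ) < 1))).exists
  refine ⟨K, R, 1 / 4, by norm_num, fun N x hx => ?_⟩
  have hmem : x ∈ translate (box d (2 * R + 1)) (x - x₀) := by
    rw [mem_translate, sub_sub_cancel]
    exact bulk_subset_box _ _ hx₀
  have hdist : ∀ y ∈ boundary (translate (box d (2 * R + 1)) (x - x₀)), R ≤ l1dist y x := by
    intro y hy
    rw [boundary_translate, mem_translate] at hy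
    rw [← l1dist_sub_right (x - x₀), sub_sub_cancel]
    exact le_l1dist_of_mem_bulk hx₀ hy
  have hle := hR β hβ x (heightIndicator K x) (heightIndicator_mem_Icc K x)
    (fun ψ ψ' h => by simp only [heightIndicator, h x rfl]) _ (box d N) hmem
    (bulk_subset_box _ _ hx) hdist fun y hy => le_l1dist_of_mem_bulk hx hy
  have htranslate : (fun ψ : (Fin d → ℤ) → ℤ => heightIndicator K x fun y => ψ (y - (x - x₀)))
      = heightIndicator K x₀ := by
    funext ψ
    simp only [heightIndicator, sub_sub_cancel]
  rw [expectation_translate, htranslate] at hle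
  linarith

end Rigidity

/-! ### Counting connected sets -/

section Counting

variable {V : Type*}

theorem exists_detour {r : V → V → Prop} {w u : V} (hwu : r w u) (huw : r u w) {l : List V}
    (hl : l.IsChain r) (hw : w ∈ l) :
    ∃ l' : List V, l'.IsChain r ∧ l'.head? = l.head? ∧ l'.length = l.length + 2 ∧
      ∀ z, z ∈ l' ↔ z = u ∨ z ∈ l := by
  obtain ⟨s, t, rfl⟩ := List.append_of_mem hw
  rw [List.isChain_split] at hl
  refine ⟨s ++ w :: u :: w :: t, List.isChain_split.2
    ⟨hl.1, List.isChain_cons_cons.2 ⟨hwu, List.isChain_cons_cons.2 ⟨huw, hl.2⟩⟩⟩, ?_, ?_,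
    fun z => ?_⟩
  · simp only [List.head?_append, List.head?_cons]
  · simp only [List.length_append, List.length_cons]
    omega
  · simp only [List.mem_append, List.mem_cons]
    tauto

variable [DecidableEq V]

/-- The lists of length `n` that continue `a` to a chain for the relation `b ∈ nbr a`. -/
def chainsFrom (nbr : V → Finset V) : ℕ → V → Finset (List V)
  | 0, _ => {[]}
  | n + 1, a => (nbr a).biUnion fun b => (chainsFrom nbr n b).image (List.cons b)

theorem card_chainsFrom_le {nbr : V → Finset V} {Δ : ℕ} (hΔ : ∀ a, (nbr a).card ≤ Δ) (n : ℕ)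
    (a : V) : (chainsFrom nbr n a).card ≤ Δ ^ n := by
  induction n generalizing a with
  | zero => rfl
  | succ n ih =>
    calc (chainsFrom nbr (n + 1) a).card
        ≤ (nbr a).card * Δ ^ n :=
          card_biUnion_le_card_mul _ _ _ fun b _ => card_image_le.trans (ih b)
      _ ≤ Δ ^ (n + 1) := by
        rw [pow_succ']
        exact Nat.mul_le_mul_right _ (hΔ a)

theorem mem_chainsFrom {nbr : V → Finset V} {t : List V} {a : V}
    (h : (a :: t).IsChain fun a b => b ∈ nbr a) : t ∈ chainsFrom nbr t.length a := by
  induction t generalizing a with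
  | nil => exact mem_singleton_self _
  | cons b t ih =>
    rw [List.isChain_cons_cons] at h
    exact mem_biUnion.2 ⟨b, h.1, mem_image_of_mem _ (ih h.2)⟩

/-- `E` is connected for the relation `r`: it is not the disjoint union of two non-empty sets
without any pair of related elements between them. -/
def IsConnectedFor (r : V → V → Prop) (E : Finset V) : Prop :=
  ∀ E' ⊆ E, E'.Nonempty → E' ≠ E → ∃ a ∈ E', ∃ b ∈ E \ E', r a b

variable {r : V → V → Prop}

theorem IsConnectedFor.exists_isChain_card_eq [Std.Symm r] {E : Finset V} {a : V}
    (ha : a ∈ E) (hE : IsConnectedFor r E) {n : ℕ} (hn : n + 1 ≤ E.card) :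
    ∃ t : List V, (a :: t).IsChain r ∧ t.length = 2 * n ∧ (a :: t).toFinset ⊆ E ∧
      (a :: t).toFinset.card = n + 1 := by
  induction n with
  | zero => exact ⟨[], List.isChain_singleton a, rfl, by simpa using ha, by simp⟩
  | succ n ih =>
    obtain ⟨t, hchain, hlen, hsub, hcard⟩ := ih (by omega)
    obtain ⟨w, hw, u, hu, hwu⟩ := hE _ hsub ⟨a, by simp⟩ (fun heq => by
      rw [heq] at hcard
      omega)
    rw [Finset.mem_sdiff] at hu
    obtain ⟨l, hchain', hhead, hlen', hmem⟩ :=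
      exists_detour hwu (symm hwu) hchain (List.mem_toFinset.1 hw)
    obtain ⟨t', rfl⟩ := List.head?_eq_some_iff.1 hhead
    have hset : (a :: t').toFinset = insert u (a :: t).toFinset := by
      ext z
      rw [List.mem_toFinset, hmem, mem_insert, List.mem_toFinset]
    refine ⟨t', hchain', ?_, ?_, ?_⟩
    · simp only [List.length_cons] at hlen'
      omega
    · rw [hset]
      exact insert_subset hu.1 hsub
    · rw [hset, card_insert_of_notMem hu.2, hcard]

theorem card_connected_le [Std.Symm r] {nbr : V → Finset V}
    (hnbr : ∀ {a b}, r a b → b ∈ nbr a) {Δ : ℕ} (hΔ : ∀ a, (nbr a).card ≤ Δ) {n : ℕ} (a : V)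
    (S : Finset (Finset V)) (hS : ∀ E ∈ S, a ∈ E ∧ IsConnectedFor r E ∧ E.card = n) :
    S.card ≤ Δ ^ (2 * (n - 1)) := by
  have hsub : S ⊆ (chainsFrom nbr (2 * (n - 1)) a).image fun t => (a :: t).toFinset := by
    intro E hE
    obtain ⟨ha, hconn, hcard⟩ := hS E hE
    have hpos : 0 < E.card := card_pos.2 ⟨a, ha⟩
    obtain ⟨t, hchain, hlen, htE, htcard⟩ :=
      hconn.exists_isChain_card_eq ha (n := n - 1) (by omega)
    exact mem_image.2 ⟨t, hlen ▸ mem_chainsFrom (hchain.imp fun _ _ => hnbr),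
      eq_of_subset_of_card_le htE (by omega)⟩
  exact (card_le_card hsub).trans (card_image_le.trans (card_chainsFrom_le hΔ _ a))

end Counting

/-! ### Edge boundaries and cocycles -/

section EdgeBoundary

/-- The edges of `ℤ^d` on the boundary of `U`; the pair `(y, i)` encodes the edge between `y`
and `y + unitVec i`. -/
def edgeBoundary (U : Finset (Fin d → ℤ)) : Finset ((Fin d → ℤ) × Fin d) :=
  (U.biUnion fun y => univ.biUnion fun i => {(y, i), (y - unitVec i, i)}).filter
    fun e => ¬ (e.1 ∈ U ↔ e.1 + unitVec e.2 ∈ U)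

theorem mem_edgeBoundary {U : Finset (Fin d → ℤ)} {e : (Fin d → ℤ) × Fin d} :
    e ∈ edgeBoundary U ↔ ¬ (e.1 ∈ U ↔ e.1 + unitVec e.2 ∈ U) := by
  obtain ⟨y, i⟩ := e
  simp only [edgeBoundary, mem_filter, mem_biUnion, mem_univ, true_and, mem_insert,
    mem_singleton, Prod.mk.injEq, and_iff_right_iff_imp]
  intro h
  by_cases hy : y ∈ U
  · exact ⟨y, hy, i, Or.inl ⟨rfl, rfl⟩⟩
  · exact ⟨_, (not_iff.1 h).1 hy, i, Or.inr ⟨(add_sub_cancel_right _ _).symm, rfl⟩⟩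

theorem exists_mem_edgeBoundary_iff {u v : Fin d → ℤ} (huv : Adj u v) :
    ∃ e : (Fin d → ℤ) × Fin d, ∀ V : Finset (Fin d → ℤ),
      e ∈ edgeBoundary V ↔ ¬ (u ∈ V ↔ v ∈ V) := by
  obtain ⟨i, rfl | rfl⟩ := adj_iff.1 huv
  · exact ⟨(u, i), fun V => mem_edgeBoundary⟩
  · exact ⟨(v, i), fun V => mem_edgeBoundary.trans (not_congr iff_comm)⟩

theorem edgeBoundary_empty : edgeBoundary (∅ : Finset (Fin d → ℤ)) = ∅ := by
  ext e
  simp [mem_edgeBoundary]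

theorem edgeBoundary_symmDiff (U V : Finset (Fin d → ℤ)) :
    edgeBoundary (symmDiff U V) = symmDiff (edgeBoundary U) (edgeBoundary V) := by
  ext e
  simp only [mem_edgeBoundary, mem_symmDiff]
  tauto

theorem exists_exit {V : Type*} [AddCommGroup V] [IsAddTorsionFree V] {U : Finset V} {y v : V}
    (hy : y ∈ U) (hv : v ≠ 0) :
    ∃ m : ℕ, (∀ j ≤ m, y + j • v ∈ U) ∧ y + (m + 1) • v ∉ U := by
  classical
  have hex : ∃ m : ℕ, y + m • v ∉ U := by
    by_contra! hall
    have hinj : Function.Injective fun m : ℕ => (⟨_, hall m⟩ : U) := fun k l hkl =>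
      (IsAddLeftRegular.all v).nsmul_injective hv (add_left_cancel (Subtype.mk.inj hkl))
    exact not_injective_infinite_finite _ hinj
  obtain ⟨m, hm⟩ : ∃ m, Nat.find hex = m + 1 :=
    Nat.exists_eq_succ_of_ne_zero fun h0 => by simpa [hy] using (Nat.find_eq_zero hex).1 h0
  exact ⟨m, fun j hj => not_not.1 (Nat.find_min hex (by omega)), hm ▸ Nat.find_spec hex⟩

theorem exit_mem_edgeBoundary {U : Finset (Fin d → ℤ)} {y : Fin d → ℤ} {i : Fin d} {m : ℕ}
    (h : y + m • unitVec i ∈ U) (h' : y + (m + 1) • unitVec i ∉ U) :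
    (y + m • unitVec i, i) ∈ edgeBoundary U := by
  rw [add_smul, one_smul, ← add_assoc] at h'
  exact mem_edgeBoundary.2 fun hiff => h' (hiff.1 h)

theorem unitVec_ne_zero (i : Fin d) : unitVec i ≠ 0 :=
  Pi.single_ne_zero_iff.2 one_ne_zero

theorem nsmul_unitVec_apply_self (n : ℕ) (i : Fin d) : (n • unitVec i) i = n := by
  simp

theorem edgeBoundary_injective [Nonempty (Fin d)] :
    Function.Injective (edgeBoundary : Finset (Fin d → ℤ) → _) := by
  intro U V h
  by_contra hne
  obtain ⟨i⟩ := ‹Nonempty (Fin d)›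
  obtain ⟨y, hy⟩ := nonempty_iff_ne_empty.2 (mt (symmDiff_eq_bot (a := U)).1 hne)
  obtain ⟨m, hm, hm'⟩ := exists_exit hy (unitVec_ne_zero i)
  have hmem := exit_mem_edgeBoundary (hm m le_rfl) hm'
  rw [edgeBoundary_symmDiff, h, symmDiff_self] at hmem
  exact notMem_empty _ hmem

end EdgeBoundary

section Cocycle

variable {A : Type*} [AddCommGroup A]

/-- The value `α y i` belongs to the edge between `y` and `y + unitVec i`; `α` is a cocycle if
its circulation around every plaquette of `ℤ^d` vanishes. -/
def IsCocycle (α : (Fin d → ℤ) → Fin d → A) : Prop :=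
  ∀ y i j, α y i + α (y + unitVec i) j = α y j + α (y + unitVec j) i

/-- The potential of `α` obtained by integrating along the half-line that arrives from infinity
in the direction `o`. -/
noncomputable def potential (α : (Fin d → ℤ) → Fin d → A) (o : Fin d) (y : Fin d → ℤ) : A :=
  ∑ᶠ k : ℕ, α (y - (k + 1) • unitVec o) o

variable {α : (Fin d → ℤ) → Fin d → A}

theorem IsCocycle.sum_range_add_unitVec (hα : IsCocycle α) (o i : Fin d) (y : Fin d → ℤ)
    (n : ℕ) :
    ∑ k ∈ range n, α (y + unitVec i - (k + 1) • unitVec o) o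
      = ∑ k ∈ range n, α (y - (k + 1) • unitVec o) o + (α y i - α (y - n • unitVec o) i) := by
  have hstep : ∀ k : ℕ, α (y + unitVec i - (k + 1) • unitVec o) o
      = α (y - (k + 1) • unitVec o) o
        + (α (y - k • unitVec o) i - α (y - (k + 1) • unitVec o) i) := by
    intro k
    have hcocycle := hα (y - (k + 1) • unitVec o) i o
    rw [show y - (k + 1) • unitVec o + unitVec i = y + unitVec i - (k + 1) • unitVec o by abel,
      show y - (k + 1) • unitVec o + unitVec o = y - k • unitVec o by
        rw [add_smul, one_smul]; abel] at hcocycle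
    rw [← add_sub_assoc, ← hcocycle, add_sub_cancel_left]
  rw [sum_congr rfl fun k _ => hstep k, sum_add_distrib,
    sum_range_sub' fun k => α (y - k • unitVec o) i, zero_smul, sub_zero]

variable {R : ℤ} (hR : ∀ y i j, R ≤ |y j| → α y i = 0)
include hR

theorem eventually_potential_eq_sum_range (o : Fin d) (y : Fin d → ℤ) :
    ∀ᶠ n in atTop, potential α o y = ∑ k ∈ range n, α (y - (k + 1) • unitVec o) o := by
  filter_upwards [eventually_ge_atTop (y o + R).toNat] with n hn
  refine finsum_eq_sum_of_support_subset _ fun k hk => mem_coe.2 (mem_range.2 ?_)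
  by_contra! hnk
  refine hk (hR _ _ o (le_abs.2 (Or.inr ?_)))
  rw [Pi.sub_apply, nsmul_unitVec_apply_self]
  push_cast
  omega

theorem IsCocycle.potential_add_unitVec (hα : IsCocycle α) (o i : Fin d) (y : Fin d → ℤ) :
    potential α o (y + unitVec i) = potential α o y + α y i := by
  obtain ⟨n, hn, hn', hfar⟩ := ((eventually_potential_eq_sum_range hR o y).and
    ((eventually_potential_eq_sum_range hR o (y + unitVec i)).and
      (eventually_ge_atTop (y o + R).toNat))).exists
  have hzero : α (y - n • unitVec o) i = 0 := hR _ _ o (le_abs.2 (Or.inr (by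
    rw [Pi.sub_apply, nsmul_unitVec_apply_self]
    omega)))
  rw [hn', hn, hα.sum_range_add_unitVec, hzero, sub_zero]

theorem potential_eq_zero_of_ne {o j : Fin d} (hj : j ≠ o) {y : Fin d → ℤ} (hy : R ≤ |y j|) :
    potential α o y = 0 := by
  refine (finsum_congr fun k => hR _ _ j ?_).trans finsum_zero
  simpa [Pi.single_eq_of_ne hj] using hy

theorem IsCocycle.potential_eq_zero [Nontrivial (Fin d)] (hα : IsCocycle α) (o : Fin d)
    {y : Fin d → ℤ} {j : Fin d} (hy : R ≤ |y j|) : potential α o y = 0 := by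
  obtain hj | rfl := ne_or_eq j o
  · exact potential_eq_zero_of_ne hR hj hy
  -- Moving sideways does not change the potential, as `α` vanishes along the way.
  obtain ⟨p, hp⟩ := exists_ne j
  have hmove : ∀ k : ℕ, potential α j (y + k • unitVec p) = potential α j y := by
    intro k
    induction k with
    | zero => rw [zero_smul, add_zero]
    | succ k ih =>
      have hzero : α (y + k • unitVec p) p = 0 :=
        hR _ _ j (by simpa [Pi.single_eq_of_ne hp.symm] using hy)
      rw [add_smul, one_smul, ← add_assoc, hα.potential_add_unitVec hR, ih, hzero, add_zero]
  rw [← hmove (R - y p).toNat]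
  refine potential_eq_zero_of_ne hR hp (le_abs.2 (Or.inl ?_))
  rw [Pi.add_apply, nsmul_unitVec_apply_self]
  omega

end Cocycle

section Plaquette

/-- The indicator function modulo `2` of a set of edges. -/
def edgeCochain (E : Finset ((Fin d → ℤ) × Fin d)) (y : Fin d → ℤ) (i : Fin d) : ZMod 2 :=
  if (y, i) ∈ E then 1 else 0

theorem isCocycle_edgeCochain_edgeBoundary (U : Finset (Fin d → ℤ)) :
    IsCocycle (edgeCochain (edgeBoundary U)) := by
  intro y i j
  have hcoboundary : ∀ z k, edgeCochain (edgeBoundary U) z k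
      = (if z ∈ U then 1 else 0) + (if z + unitVec k ∈ U then 1 else 0) := by
    intro z k
    by_cases hz : z ∈ U <;> by_cases hzk : z + unitVec k ∈ U <;>
      simp [edgeCochain, mem_edgeBoundary, hz, hzk, CharTwo.add_self_eq_zero]
  simp only [hcoboundary, add_right_comm y (unitVec j)]
  linear_combination (if y + unitVec i ∈ U then (1 : ZMod 2) else 0) *
    (CharTwo.two_eq_zero (R := ZMod 2)) - (if y + unitVec j ∈ U then (1 : ZMod 2) else 0) *
    (CharTwo.two_eq_zero (R := ZMod 2))

theorem exists_edgeBoundary_eq [Nontrivial (Fin d)] {E : Finset ((Fin d → ℤ) × Fin d)}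
    (hE : IsCocycle (edgeCochain E)) : ∃ G : Finset (Fin d → ℤ), edgeBoundary G = E := by
  obtain ⟨R, hR⟩ : ∃ R : ℤ, ∀ y i j, R ≤ |y j| → edgeCochain E y i = 0 := by
    obtain ⟨M, hM⟩ := ((E ×ˢ univ).image fun q : ((Fin d → ℤ) × Fin d) × Fin d =>
      |q.1.1 q.2|).exists_le
    refine ⟨M + 1, fun y i j hy => if_neg fun hmem => ?_⟩
    have := hM _ (mem_image_of_mem _ (mk_mem_product hmem (mem_univ j)))
    simp only at this
    omega
  obtain ⟨o⟩ := (inferInstance : Nonempty (Fin d))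
  let g := potential (edgeCochain E) o
  refine ⟨(Finset.Icc (fun _ => -R) (fun _ => R)).filter fun y => g y = 1, ?_⟩
  have hmem : ∀ y, y ∈ (Finset.Icc (fun _ : Fin d => -R) (fun _ => R)).filter
      (fun y => g y = 1) ↔ g y = 1 := by
    refine fun y => mem_filter.trans (and_iff_right_of_imp fun hy => ?_)
    have hlt : ∀ j, |y j| < R := fun j => by
      by_contra! hj
      exact zero_ne_one ((hE.potential_eq_zero hR o hj).symm.trans hy)
    exact Finset.mem_Icc.2 ⟨fun j => (abs_lt.1 (hlt j)).1.le, fun j => (abs_lt.1 (hlt j)).2.le⟩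
  ext ⟨y, i⟩
  have hedge : (y, i) ∈ E ↔ edgeCochain E y i = 1 := by simp [edgeCochain]
  have hparity : ∀ a b : ZMod 2, ¬ (a = 1 ↔ a + b = 1) ↔ b = 1 := by decide
  have hstep : g (y + unitVec i) = g y + edgeCochain E y i := hE.potential_add_unitVec hR o i y
  rw [mem_edgeBoundary, hmem, hmem, hstep, hparity, hedge]

/-- The edges of the plaquette at `y` in the directions `i` and `j`. -/
def plaquette (y : Fin d → ℤ) (i j : Fin d) : Finset ((Fin d → ℤ) × Fin d) :=
  {(y, i), (y + unitVec i, j), (y, j), (y + unitVec j, i)}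

/-- The relation between edges that lie on a common plaquette. -/
def SharePlaquette (a b : (Fin d → ℤ) × Fin d) : Prop :=
  ∃ y i j, a ∈ plaquette y i j ∧ b ∈ plaquette y i j

instance : Std.Symm (SharePlaquette (d := d)) :=
  ⟨fun _ _ ⟨y, i, j, ha, hb⟩ => ⟨y, i, j, hb, ha⟩⟩

theorem IsCocycle.edgeCochain_of_subset {E F : Finset ((Fin d → ℤ) × Fin d)}
    (hF : IsCocycle (edgeCochain F)) (hEF : E ⊆ F)
    (hsat : ∀ a ∈ E, ∀ b ∈ F \ E, ¬ SharePlaquette a b) : IsCocycle (edgeCochain E) := by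
  intro y i j
  have hmem : (y, i) ∈ plaquette y i j ∧ (y + unitVec i, j) ∈ plaquette y i j ∧
      (y, j) ∈ plaquette y i j ∧ (y + unitVec j, i) ∈ plaquette y i j := by
    simp [plaquette]
  obtain ⟨h1, h2, h3, h4⟩ := hmem
  by_cases hmeet : ∃ a ∈ E, a ∈ plaquette y i j
  · obtain ⟨a, ha, hap⟩ := hmeet
    have hiff : ∀ z k, (z, k) ∈ plaquette y i j → edgeCochain E z k = edgeCochain F z k :=
      fun z k hb => if_congr ⟨fun h => hEF h, fun h => by_contra fun hbE =>
        hsat a ha _ (mem_sdiff.2 ⟨h, hbE⟩) ⟨y, i, j, hap, hb⟩⟩ rfl rfl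
    rw [hiff _ _ h1, hiff _ _ h2, hiff _ _ h3, hiff _ _ h4]
    exact hF y i j
  · have hzero : ∀ z k, (z, k) ∈ plaquette y i j → edgeCochain E z k = 0 :=
      fun z k hb => if_neg fun h => hmeet ⟨_, h, hb⟩
    rw [hzero _ _ h1, hzero _ _ h2, hzero _ _ h3, hzero _ _ h4]

end Plaquette

/-! ### Islands of minimal boundary -/

section Island

/-- `U` contains `x`, and the heights are positive along the inner boundary of `U` and
non-positive along its outer boundary. -/
def IsPositiveIsland (ψ : (Fin d → ℤ) → ℤ) (x : Fin d → ℤ) (U : Finset (Fin d → ℤ)) : Prop :=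
  x ∈ U ∧ ∀ u ∈ U, ∀ v ∉ U, Adj u v → 1 ≤ ψ u ∧ ψ v ≤ 0

/-- `U` is an island with the least possible number of boundary edges. -/
abbrev IsMinimalIsland (ψ : (Fin d → ℤ) → ℤ) (x : Fin d → ℤ) (U : Finset (Fin d → ℤ)) : Prop :=
  MinimalFor (IsPositiveIsland ψ x) (fun V => (edgeBoundary V).card) U

variable {ψ : (Fin d → ℤ) → ℤ} {x : Fin d → ℤ}

theorem IsPositiveIsland.of_edgeBoundary_subset {U V : Finset (Fin d → ℤ)}
    (hU : IsPositiveIsland ψ x U) (hx : x ∈ V) (hUV : V ⊆ U ∨ U ⊆ V)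
    (hsub : edgeBoundary V ⊆ edgeBoundary U) : IsPositiveIsland ψ x V := by
  refine ⟨hx, fun u hu v hv huv => ?_⟩
  obtain ⟨e, he⟩ := exists_mem_edgeBoundary_iff huv
  have hedge : ¬ (u ∈ U ↔ v ∈ U) := (he U).1 (hsub ((he V).2 (by tauto)))
  rcases hUV with hVU | hUV
  · exact hU.2 u (hVU hu) v (fun hvU => hedge (iff_of_true (hVU hu) hvU)) huv
  · have hvU : v ∉ U := fun h => hv (hUV h)
    exact hU.2 u (by tauto) v hvU huv

theorem IsMinimalIsland.eq_of_edgeBoundary_subset [Nonempty (Fin d)] {U V : Finset (Fin d → ℤ)}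
    (hU : IsMinimalIsland ψ x U) (hx : x ∈ V) (hUV : V ⊆ U ∨ U ⊆ V)
    (hsub : edgeBoundary V ⊆ edgeBoundary U) : V = U :=
  edgeBoundary_injective <| eq_of_subset_of_card_le hsub <|
    hU.2 (hU.1.of_edgeBoundary_subset hx hUV hsub) (card_le_card hsub)

theorem IsMinimalIsland.eq_empty_of_symmDiff [Nonempty (Fin d)] {G G' : Finset (Fin d → ℤ)}
    (hU : IsMinimalIsland ψ x (symmDiff G G'))
    (hdis : Disjoint (edgeBoundary G) (edgeBoundary G')) (hx : x ∈ G) : G' = ∅ := by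
  have hx' : x ∉ G' := fun h => by simpa [mem_symmDiff, hx, h] using hU.1.1
  have hsub : edgeBoundary (G \ G') ⊆ edgeBoundary (symmDiff G G') ∧
      edgeBoundary (G ∪ G') ⊆ edgeBoundary (symmDiff G G') := by
    simp only [disjoint_left, mem_edgeBoundary] at hdis
    constructor <;> intro e <;> grind [mem_edgeBoundary, mem_symmDiff]
  have hdiff := hU.eq_of_edgeBoundary_subset (mem_sdiff.2 ⟨hx, hx'⟩)
    (Or.inl le_sup_left) hsub.1
  have hunion := hU.eq_of_edgeBoundary_subset (mem_union_left _ hx)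
    (Or.inr symmDiff_le_sup) hsub.2
  have hle : G' ⊆ G \ G' := hdiff.trans hunion.symm ▸ subset_union_right
  exact eq_empty_of_forall_notMem fun y hy => (mem_sdiff.1 (hle hy)).2 hy

theorem IsMinimalIsland.isConnectedFor_edgeBoundary [Nontrivial (Fin d)]
    {U : Finset (Fin d → ℤ)} (hU : IsMinimalIsland ψ x U) :
    IsConnectedFor SharePlaquette (edgeBoundary U) := by
  intro E hE hne hne'
  by_contra! hsat
  have hcocycle := isCocycle_edgeCochain_edgeBoundary U
  obtain ⟨G, hG⟩ := exists_edgeBoundary_eq (hcocycle.edgeCochain_of_subset hE hsat)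
  obtain ⟨G', hG'⟩ := exists_edgeBoundary_eq (hcocycle.edgeCochain_of_subset sdiff_subset
    fun a ha b hb hab => hsat b (by rwa [Finset.sdiff_sdiff_eq_self hE] at hb) a ha (symm hab))
  have hdis : Disjoint (edgeBoundary G) (edgeBoundary G') := by
    rw [hG, hG']
    exact disjoint_sdiff
  have hsymm : U = symmDiff G G' := edgeBoundary_injective <| by
    rw [edgeBoundary_symmDiff, hdis.symmDiff_eq_sup, hG, hG', sup_eq_union,
      union_sdiff_of_subset hE]
  have hGG' : IsMinimalIsland ψ x (symmDiff G G') := hsymm ▸ hU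
  rcases mem_symmDiff.1 hGG'.1.1 with ⟨hx, -⟩ | ⟨hx, -⟩
  · rw [hGG'.eq_empty_of_symmDiff hdis hx, edgeBoundary_empty] at hG'
    exact hne' (hE.antisymm (sdiff_eq_empty_iff_subset.1 hG'.symm))
  · rw [symmDiff_comm] at hGG'
    rw [hGG'.eq_empty_of_symmDiff hdis.symm hx, edgeBoundary_empty] at hG
    exact hne.ne_empty hG.symm

theorem exists_isMinimalIsland {Λ : Finset (Fin d → ℤ)} (φ : Λ → ℤ) (hx : 1 ≤ extend φ x) :
    ∃ U, IsMinimalIsland (extend φ) x U := by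
  have hmem : ∀ y, y ∈ Λ.filter (fun y => 1 ≤ extend φ y) ↔ 1 ≤ extend φ y := by
    refine fun y => mem_filter.trans (and_iff_right_of_imp fun hy => ?_)
    by_contra hΛ
    simp [extend_of_notMem φ hΛ] at hy
  refine exists_minimalFor_of_wellFoundedLT (IsPositiveIsland (extend φ) x) _
    ⟨Λ.filter fun y => 1 ≤ extend φ y, (hmem x).2 hx, fun u hu v hv _ => ?_⟩
  rw [hmem] at hu hv
  omega

theorem exists_ray_notMem_box {N : ℕ} {u : Fin d → ℤ} (hu : u ∉ box d N) :
    ∃ v : Fin d → ℤ, v ≠ 0 ∧ (∀ y, Adj y (y + v)) ∧ ∀ m : ℕ, u + m • v ∉ box d N := by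
  simp only [mem_box, not_forall, not_and_or, not_le] at hu
  obtain ⟨i, hi | hi⟩ := hu
  · refine ⟨-unitVec i, neg_ne_zero.2 (unitVec_ne_zero i), fun y => ?_, fun m hm => ?_⟩
    · simpa [adj_comm] using adj_add_unitVec (y + -unitVec i) i
    · have := (mem_box.1 hm i).1
      simp at this
      omega
  · refine ⟨unitVec i, unitVec_ne_zero i, fun y => adj_add_unitVec y i, fun m hm => ?_⟩
    have := (mem_box.1 hm i).2
    simp at this
    omega

theorem IsPositiveIsland.subset_box {N : ℕ} {φ : box d N → ℤ} {U : Finset (Fin d → ℤ)}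
    (hU : IsPositiveIsland (extend φ) x U) : U ⊆ box d N := by
  intro u hu
  by_contra hbox
  obtain ⟨v, hv, hadj, hray⟩ := exists_ray_notMem_box hbox
  obtain ⟨m, hm, hm'⟩ := exists_exit hu hv
  rw [add_smul, one_smul, ← add_assoc] at hm'
  have hpos := (hU.2 _ (hm m le_rfl) _ hm' (hadj _)).1
  rw [extend_of_notMem φ (hray m)] at hpos
  omega

end Island

/-! ### The Peierls argument -/

section Contours

theorem plaquette_comm (y : Fin d → ℤ) (i j : Fin d) : plaquette y i j = plaquette y j i := by
  ext e
  simp only [plaquette, mem_insert, mem_singleton]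
  tauto

/-- The edges that share a plaquette with a given edge. -/
def edgeNeighbours (e : (Fin d → ℤ) × Fin d) : Finset ((Fin d → ℤ) × Fin d) :=
  univ.biUnion fun j => plaquette e.1 e.2 j ∪ plaquette (e.1 - unitVec j) e.2 j

theorem card_edgeNeighbours_le (e : (Fin d → ℤ) × Fin d) :
    (edgeNeighbours e).card ≤ 8 * d := by
  calc (edgeNeighbours e).card
      ≤ (univ : Finset (Fin d)).card * (4 + 4) := card_biUnion_le_card_mul _ _ _ fun j _ =>
        (card_union_le _ _).trans (add_le_add card_le_four card_le_four)
    _ = 8 * d := by rw [card_univ, Fintype.card_fin, mul_comm]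

theorem SharePlaquette.mem_edgeNeighbours {a b : (Fin d → ℤ) × Fin d} (h : SharePlaquette a b) :
    b ∈ edgeNeighbours a := by
  obtain ⟨y, i, j, ha, hb⟩ := h
  simp only [edgeNeighbours, mem_biUnion, mem_univ, true_and, mem_union]
  simp only [plaquette, mem_insert, mem_singleton] at ha
  rcases ha with rfl | rfl | rfl | rfl
  · exact ⟨j, Or.inl hb⟩
  · exact ⟨i, Or.inr (by rwa [add_sub_cancel_right, plaquette_comm])⟩
  · exact ⟨i, Or.inl (by rwa [plaquette_comm])⟩
  · exact ⟨j, Or.inr (by rwa [add_sub_cancel_right])⟩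

theorem exists_mem_edgeBoundary_of_mem {o p : Fin d} (hpo : p ≠ o) {U : Finset (Fin d → ℤ)}
    {x : Fin d → ℤ} (hx : x ∈ U) :
    ∃ k < (edgeBoundary U).card, (x + k • unitVec o, o) ∈ edgeBoundary U := by
  obtain ⟨k, hk, hk'⟩ := exists_exit hx (unitVec_ne_zero o)
  refine ⟨k, ?_, exit_mem_edgeBoundary (hk k le_rfl) hk'⟩
  -- The rays in the direction `p` from the `k + 1` sites `x + j • unitVec o` leave `U` through
  -- distinct edges.
  have hray : ∀ j : ℕ, ∃ m : ℕ, j ≤ k →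
      (x + j • unitVec o + m • unitVec p, p) ∈ edgeBoundary U := fun j => by
    by_cases hj : j ≤ k
    · obtain ⟨m, hm, hm'⟩ := exists_exit (hk j hj) (unitVec_ne_zero p)
      exact ⟨m, fun _ => exit_mem_edgeBoundary (hm m le_rfl) hm'⟩
    · exact ⟨0, fun h => absurd h hj⟩
  choose m hm using hray
  have hcard : (range (k + 1)).card ≤ (edgeBoundary U).card := by
    refine card_le_card_of_injOn (fun j => (x + j • unitVec o + m j • unitVec p, p))
      (fun j hj => hm j (Nat.lt_succ_iff.1 (mem_range.1 hj))) fun j _ l _ hjl => ?_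
    simpa [Pi.single_eq_of_ne hpo.symm] using congrFun (congrArg Prod.fst hjl) o
  rwa [card_range] at hcard

theorem card_contours_le [Nontrivial (Fin d)] {x : Fin d → ℤ} {ℓ : ℕ}
    (S : Finset (Finset (Fin d → ℤ))) (hS : ∀ U ∈ S, x ∈ U ∧
      IsConnectedFor SharePlaquette (edgeBoundary U) ∧ (edgeBoundary U).card = ℓ) :
    S.card ≤ ℓ * (8 * d) ^ (2 * (ℓ - 1)) := by
  obtain ⟨o, p, hop⟩ := exists_pair_ne (Fin d)
  let e : ℕ → (Fin d → ℤ) × Fin d := fun k => (x + k • unitVec o, o)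
  calc S.card = (S.image edgeBoundary).card :=
        (card_image_of_injective S edgeBoundary_injective).symm
    _ ≤ ((range ℓ).biUnion fun k => (S.image edgeBoundary).filter (e k ∈ ·)).card := by
        refine card_le_card fun E hE => ?_
        obtain ⟨U, hU, rfl⟩ := mem_image.1 hE
        obtain ⟨hx, -, rfl⟩ := hS U hU
        obtain ⟨k, hk, hmem⟩ := exists_mem_edgeBoundary_of_mem hop.symm hx
        exact mem_biUnion.2 ⟨k, mem_range.2 hk, mem_filter.2 ⟨hE, hmem⟩⟩
    _ ≤ (range ℓ).card * (8 * d) ^ (2 * (ℓ - 1)) := by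
        refine card_biUnion_le_card_mul _ _ _ fun k _ => card_connected_le
          SharePlaquette.mem_edgeNeighbours card_edgeNeighbours_le (e k) _ fun E hE => ?_
        obtain ⟨hES, hmem⟩ := mem_filter.1 hE
        obtain ⟨U, hU, rfl⟩ := mem_image.1 hES
        exact ⟨hmem, (hS U hU).2⟩
    _ = ℓ * (8 * d) ^ (2 * (ℓ - 1)) := by rw [card_range]

theorem sum_exp_neg_mul_le {ι : Type*} {s : Finset ι} {w : ι → ℕ} {D β q : ℝ} (hD : 1 ≤ D)
    (hcard : ∀ ℓ, ((s.filter fun a => w a = ℓ).card : ℝ) ≤ ℓ * D ^ (ℓ - 1))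
    (hDq : D * Real.exp (-β) ≤ q) (hq : q < 1) :
    ∑ a ∈ s, Real.exp (-β * w a) ≤ q / (1 - q) ^ 2 := by
  have hq0 : 0 ≤ q := le_trans (by positivity) hDq
  have hgeom := hasSum_coe_mul_geometric_of_norm_lt_one (𝕜 := ℝ)
    (by rwa [Real.norm_of_nonneg hq0] : ‖q‖ < 1)
  have hlevel : ∀ ℓ : ℕ, ((s.filter fun a => w a = ℓ).card : ℝ) * Real.exp (-β * ℓ)
      ≤ ℓ * q ^ ℓ := fun ℓ => by
    calc ((s.filter fun a => w a = ℓ).card : ℝ) * Real.exp (-β * ℓ)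
        ≤ ℓ * D ^ ℓ * Real.exp (-β * ℓ) := by
          refine mul_le_mul_of_nonneg_right ((hcard ℓ).trans ?_) (Real.exp_pos _).le
          gcongr
          exact ℓ.sub_le 1
      _ = ℓ * (D * Real.exp (-β)) ^ ℓ := by
          rw [mul_comm (-β), Real.exp_nat_mul, mul_pow, mul_assoc]
      _ ≤ ℓ * q ^ ℓ := by gcongr
  calc ∑ a ∈ s, Real.exp (-β * w a)
      = ∑ ℓ ∈ s.image w, ∑ a ∈ s with w a = ℓ, Real.exp (-β * w a) :=
        (sum_fiberwise_of_maps_to (fun a ha => mem_image_of_mem _ ha) _).symm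
    _ ≤ ∑ ℓ ∈ s.image w, (ℓ : ℝ) * q ^ ℓ := sum_le_sum fun ℓ _ => by
        rw [sum_congr rfl fun a ha => by rw [(mem_filter.1 ha).2], sum_const, nsmul_eq_mul]
        exact hlevel ℓ
    _ ≤ ∑' ℓ : ℕ, (ℓ : ℝ) * q ^ ℓ := hgeom.summable.sum_le_tsum _ fun _ _ => by positivity
    _ = q / (1 - q) ^ 2 := hgeom.tsum_eq

/-- An inverse temperature above which the entropy of the contours, at most `(8 * d) ^ 2` per
edge, is beaten by their energy, with a factor `16` to spare. -/
noncomputable def peierlsThreshold (d : ℕ) : ℝ :=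
  Real.log (16 * (8 * d) ^ 2)

theorem peierlsThreshold_pos [Nonempty (Fin d)] : 0 < peierlsThreshold d := by
  have hd : (1 : ℝ) ≤ d := Nat.one_le_cast.2 (Fin.pos_iff_nonempty.2 ‹_›)
  exact Real.log_pos (by nlinarith)

theorem sum_exp_contours_le [Nontrivial (Fin d)] {x : Fin d → ℤ} {β : ℝ}
    (hβ : peierlsThreshold d ≤ β) (S : Finset (Finset (Fin d → ℤ)))
    (hS : ∀ U ∈ S, x ∈ U ∧ IsConnectedFor SharePlaquette (edgeBoundary U)) :
    ∑ U ∈ S, Real.exp (-β * (edgeBoundary U).card) ≤ 1 / 4 := by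
  have hd : (1 : ℝ) ≤ d := Nat.one_le_cast.2 (Fin.pos_iff_nonempty.2 inferInstance)
  have hcard : ∀ ℓ, ((S.filter fun U => (edgeBoundary U).card = ℓ).card : ℝ)
      ≤ ℓ * ((8 * d) ^ 2) ^ (ℓ - 1) := fun ℓ => by
    rw [← pow_mul]
    exact_mod_cast card_contours_le (x := x) _ fun U hU =>
      ⟨(hS U (mem_filter.1 hU).1).1, (hS U (mem_filter.1 hU).1).2, (mem_filter.1 hU).2⟩
  have hexp : (8 * d : ℝ) ^ 2 * Real.exp (-β) ≤ 1 / 16 := by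
    have := (Real.log_le_iff_le_exp (by positivity)).1 hβ
    rw [Real.exp_neg, ← div_eq_mul_inv, div_le_iff₀ (Real.exp_pos β)]
    linarith
  refine (sum_exp_neg_mul_le (by nlinarith) hcard hexp (by norm_num)).trans ?_
  norm_num

end Contours

section Lower

variable {Λ U : Finset (Fin d → ℤ)} {x : Fin d → ℤ}

/-- The configuration `φ` lowered by one on `U`. -/
def lower (U : Finset (Fin d → ℤ)) : (Λ → ℤ) ≃ (Λ → ℤ) :=
  Equiv.subRight fun y => if y.1 ∈ U then 1 else 0

theorem extend_lower (hU : U ⊆ Λ) (φ : Λ → ℤ) (y : Fin d → ℤ) :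
    extend (lower U φ) y = extend φ y - if y ∈ U then 1 else 0 := by
  by_cases hy : y ∈ Λ
  · rw [extend_apply _ (⟨y, hy⟩ : Λ), extend_apply _ (⟨y, hy⟩ : Λ)]
    rfl
  · rw [extend_of_notMem _ hy, extend_of_notMem _ hy, if_neg fun h => hy (hU h), sub_zero]

theorem IsPositiveIsland.abs_sub_lower_add {ψ : (Fin d → ℤ) → ℤ} (hU : IsPositiveIsland ψ x U)
    {u v : Fin d → ℤ} (huv : Adj u v) :
    |(ψ v - if v ∈ U then 1 else 0) - (ψ u - if u ∈ U then 1 else 0)|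
      + (if ¬ (u ∈ U ↔ v ∈ U) then 1 else 0) = |ψ v - ψ u| := by
  have hout := hU.2 u
  have hin := hU.2 v
  grind [adj_comm]

theorem edgeBoundary_subset_product (hU : U ⊆ Λ) :
    edgeBoundary U ⊆ (Λ ∪ boundary Λ) ×ˢ univ := by
  intro e he
  refine mem_product.2 ⟨?_, mem_univ _⟩
  by_cases h : e.1 ∈ Λ
  · exact mem_union_left _ h
  · have hmem : e.1 + unitVec e.2 ∈ U :=
      (not_iff.1 (mem_edgeBoundary.1 he)).1 fun heU => h (hU heU)
    exact mem_union_right _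
      ((mem_boundary _ _).2 ⟨h, _, hU hmem, adj_comm.1 (adj_add_unitVec e.1 e.2)⟩)

theorem IsPositiveIsland.hamiltonian_lower_add_card {φ : Λ → ℤ} (hUΛ : U ⊆ Λ)
    (hU : IsPositiveIsland (extend φ) x U) :
    hamiltonian Λ 0 (lower U φ) + (edgeBoundary U).card = hamiltonian Λ 0 φ := by
  have hcard : ((edgeBoundary U).card : ℝ)
      = ∑ e ∈ (Λ ∪ boundary Λ) ×ˢ univ, if e ∈ edgeBoundary U then (1 : ℝ) else 0 := by
    rw [sum_boole, filter_mem_eq_inter, inter_eq_right.2 (edgeBoundary_subset_product hUΛ)]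
  rw [hamiltonian_eq_sum subset_rfl, hamiltonian_eq_sum subset_rfl, ← sum_product',
    ← sum_product', hcard, ← sum_add_distrib]
  refine sum_congr rfl fun e _ => ?_
  simp only [extend_lower hUΛ, mem_edgeBoundary]
  exact_mod_cast hU.abs_sub_lower_add (adj_add_unitVec e.1 e.2)

end Lower

open Classical in
/-- The sets `U ⊆ Λ` around `x` whose boundary is a single contour. -/
noncomputable def contourInteriors (Λ : Finset (Fin d → ℤ)) (x : Fin d → ℤ) :
    Finset (Finset (Fin d → ℤ)) :=
  Λ.powerset.filter fun U => x ∈ U ∧ IsConnectedFor SharePlaquette (edgeBoundary U)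

theorem mem_contourInteriors {Λ U : Finset (Fin d → ℤ)} {x : Fin d → ℤ} :
    U ∈ contourInteriors Λ x ↔
      U ⊆ Λ ∧ x ∈ U ∧ IsConnectedFor SharePlaquette (edgeBoundary U) := by
  simp only [contourInteriors, mem_filter, mem_powerset]

section Peierls

variable [Nontrivial (Fin d)]

theorem exp_hamiltonian_le_sum (β : ℝ) {N : ℕ} {φ : box d N → ℤ} {x : Fin d → ℤ}
    (hx : 1 ≤ extend φ x) :
    Real.exp (-β * hamiltonian (box d N) 0 φ)
      ≤ ∑ U ∈ contourInteriors (box d N) x, Real.exp (-β * (edgeBoundary U).card)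
        * Real.exp (-β * hamiltonian (box d N) 0 (lower U φ)) := by
  obtain ⟨U, hU⟩ := exists_isMinimalIsland φ hx
  have hbox : U ⊆ box d N := hU.1.subset_box
  have hmem : U ∈ contourInteriors (box d N) x :=
    mem_contourInteriors.2 ⟨hbox, hU.1.1, hU.isConnectedFor_edgeBoundary⟩
  calc Real.exp (-β * hamiltonian (box d N) 0 φ)
      = Real.exp (-β * (edgeBoundary U).card)
        * Real.exp (-β * hamiltonian (box d N) 0 (lower U φ)) := by
        rw [← Real.exp_add, ← hU.1.hamiltonian_lower_add_card hbox, mul_add, add_comm]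
    _ ≤ _ := single_le_sum (f := fun U => Real.exp (-β * (edgeBoundary U).card)
        * Real.exp (-β * hamiltonian (box d N) 0 (lower U φ))) (fun _ _ => by positivity) hmem

theorem expectation_pos_height_le {β : ℝ} (hβ : peierlsThreshold d ≤ β) (N : ℕ)
    (x : Fin d → ℤ) :
    expectation (box d N) β (fun ψ => if 1 ≤ ψ x then 1 else 0) ≤ 1 / 4 := by
  have hβ0 : 0 < β := peierlsThreshold_pos.trans_le hβ
  set Λ := box d N
  have hs := summable_exp_hamiltonian Λ hβ0 0
  have hsum : ∀ U ∈ contourInteriors Λ x, Summable fun φ : Λ → ℤ =>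
      Real.exp (-β * (edgeBoundary U).card)
        * Real.exp (-β * hamiltonian Λ 0 (lower U φ)) := fun U _ =>
    ((lower U).summable_iff.2 hs).mul_left _
  rw [expectation, div_le_iff₀ (partitionSOS_pos Λ hβ0 0)]
  calc ∑' φ : Λ → ℤ, (if 1 ≤ extend φ x then (1 : ℝ) else 0)
        * Real.exp (-β * hamiltonian Λ 0 φ)
      ≤ ∑' φ : Λ → ℤ, ∑ U ∈ contourInteriors Λ x, Real.exp (-β * (edgeBoundary U).card)
          * Real.exp (-β * hamiltonian Λ 0 (lower U φ)) := by
        refine Summable.tsum_le_tsum (fun φ => ?_) (summable_mul_of_abs_le (M := 1) hs fun φ => ?_)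
          (summable_sum hsum)
        · split_ifs with hx
          · rw [one_mul]
            exact exp_hamiltonian_le_sum β hx
          · rw [zero_mul]
            exact sum_nonneg fun _ _ => by positivity
        · split_ifs <;> simp
    _ = (∑ U ∈ contourInteriors Λ x, Real.exp (-β * (edgeBoundary U).card))
          * partitionSOS Λ β 0 := by
        rw [Summable.tsum_finsetSum hsum, sum_mul]
        refine sum_congr rfl fun U _ => ?_
        rw [tsum_mul_left, (lower U).tsum_eq fun φ => Real.exp (-β * hamiltonian Λ 0 φ),
          partitionSOS]
    _ ≤ 1 / 4 * partitionSOS Λ β 0 :=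
        mul_le_mul_of_nonneg_right
          (sum_exp_contours_le hβ _ fun U hU => (mem_contourInteriors.1 hU).2)
          (partitionSOS_pos Λ hβ0 0).le

end Peierls

theorem expectation_comp_neg (Λ : Finset (Fin d → ℤ)) (β : ℝ) (f : ((Fin d → ℤ) → ℤ) → ℝ) :
    expectation Λ β (fun ψ => f (-ψ)) = expectation Λ β f := by
  unfold expectation
  rw [← (Equiv.neg (Λ → ℤ)).tsum_eq fun φ => f (extend φ) * _]
  congr 2 with φ
  rw [Equiv.neg_apply, hamiltonian_neg, funext (extend_neg φ)]
  rfl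

theorem isTight_of_peierlsThreshold_le [Nontrivial (Fin d)] {β : ℝ}
    (hβ : peierlsThreshold d ≤ β) : IsTight d β := by
  have hβ0 : 0 < β := peierlsThreshold_pos.trans_le hβ
  refine ⟨0, 0, 1 / 2, by norm_num, fun N x _ => ?_⟩
  let P : ((Fin d → ℤ) → ℤ) → ℝ := fun ψ => if 1 ≤ ψ x then 1 else 0
  have hI : ∀ ψ, |heightIndicator 0 x ψ| ≤ 1 := fun ψ => by
    have hmem := heightIndicator_mem_Icc 0 x ψ
    exact (abs_of_nonneg hmem.1).trans_le hmem.2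
  have hP : ∀ ψ, |P ψ| ≤ 1 := fun ψ => by
    simp only [P]
    split_ifs <;> simp
  have hsplit : ∀ ψ, heightIndicator 0 x ψ + (P (-ψ) + P ψ) = 1 := fun ψ => by
    simp only [heightIndicator, P, Pi.neg_apply, Nat.cast_zero, abs_nonpos_iff]
    obtain h | h | h := lt_trichotomy (ψ x) 0 <;> grind
  have htotal : expectation (box d N) β (heightIndicator 0 x)
      + (expectation (box d N) β P + expectation (box d N) β P) = 1 := by
    nth_rw 2 [← expectation_comp_neg]
    rw [← expectation_add _ hβ0 (fun ψ => hP (-ψ)) hP, ← expectation_add _ hβ0 hI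
      fun ψ => (abs_add_le _ _).trans (add_le_add (hP (-ψ)) (hP ψ))]
    simp only [hsplit, expectation_const _ hβ0]
  have hpos : expectation (box d N) β P ≤ 1 / 4 := expectation_pos_height_le hβ N x
  linarith

end SOS

theorem proposition2p3 (d : ℕ) (hd : 2 ≤ d) :
    ∃ b : ℝ, 0 < b ∧ ∀ β : ℝ,
      (b ≤ β ∨ ∃ β₀ : ℝ, SOS.IsRigidityThreshold d β₀ ∧ β₀ ≤ β) →
        -- the limits that define the free energies exist, for every boundary condition
        (∀ n : ℤ, Filter.Tendsto
          (fun N : ℕ => Real.log (SOS.partitionSOS (SOS.box d N) β n) / (N : ℝ) ^ d)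
          Filter.atTop (nhds (SOS.freeEnergySOS d β))) ∧
        (∀ (n : ℤ) (h : ℝ), Filter.Tendsto
          (fun N : ℕ => Real.log (SOS.partition (SOS.box d N) β n h) / (N : ℝ) ^ d)
          Filter.atTop (nhds (SOS.freeEnergy d β h))) ∧
        -- the critical point
        SOS.criticalPoint d β = 0 ∧
        -- linear behaviour at the right of the critical point
        (∃ c : ℝ, 0 < c ∧ Asymptotics.IsEquivalent (nhdsWithin 0 (Set.Ioi 0))
          (fun h : ℝ => SOS.reducedFreeEnergy d β h) (fun h : ℝ => c * h)) ∧
        -- the transition is of first order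
        ¬ DifferentiableAt ℝ (fun h : ℝ => SOS.reducedFreeEnergy d β h) 0 := by
  have : Nontrivial (Fin d) := Fin.nontrivial_iff_two_le.2 hd
  refine ⟨SOS.peierlsThreshold d, SOS.peierlsThreshold_pos, fun β hβ => ?_⟩
  obtain ⟨hβ_pos, htight⟩ : 0 < β ∧ SOS.IsTight d β := by
    rcases hβ with hβ | ⟨β₀, hrig, hβ⟩
    · exact ⟨SOS.peierlsThreshold_pos.trans_le hβ, SOS.isTight_of_peierlsThreshold_le hβ⟩
    · exact ⟨hrig.1.trans_le hβ, hrig.isTight hβ⟩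
  obtain ⟨κ, hκ, hκF⟩ := htight.exists_mul_le hβ_pos
  obtain ⟨c, hc, hderiv⟩ := SOS.exists_pos_hasDerivWithinAt_Ioi
    (SOS.convexOn_reducedFreeEnergy hβ_pos) (SOS.reducedFreeEnergy_zero d β) hκ hκF
  exact ⟨SOS.tendsto_log_partitionSOS hβ_pos, SOS.tendsto_log_partition hβ_pos,
    SOS.criticalPoint_eq_zero hβ_pos fun h hh => (mul_pos hκ hh).trans_le (hκF h hh.le),
    ⟨c, hc, SOS.isEquivalent_of_hasDerivWithinAt_Ioi (SOS.reducedFreeEnergy_zero d β) hc.ne'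
      hderiv⟩,
    SOS.not_differentiableAt_of_hasDerivWithinAt_Ioi
      (fun _ => SOS.reducedFreeEnergy_of_nonpos hβ_pos) hc.ne' hderiv⟩
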